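/- Let $\mathcal H$ be a complex Hilbert space and let $\mathcal F=\{f_i\}_{i\ge 1}$ be a frame in a closed subspace $\mathcal K\subseteq\mathcal H$, that is, $f_i\in\mathcal K$ for all $i$ and there are $A,B>0$ with $A\|g\|^2\le\sum_i|\langle g,f_i\rangle|^2\le B\|g\|^2$ for all $g\in\mathcal K$ (a Parseval frame in a closed subspace is one with $A=B=1$). Let $F:\ell^2\to\mathcal H$, $Fe_i=f_i$, be its synthesis operator, where $\{e_i\}$ is the standard basis of the complex space $\ell^2$. Let $F=U|F|$ be the polar decomposition ($U$ is the partial isometry with $\ker U=\ker F$), and let $u_i=Ue_i$. Let $\mathcal Q_{\mathcal F}$ be the set of all Parseval frames $\{x_i\}$ in closed subspaces of $\mathcal H$ with $\sum_i\|x_i-f_i\|^2<\infty$, and assume $\mathcal Q_{\mathcal F}\ne\emptyset$. For an integer $k$, let $\mathcal Q_{\mathcal F}^k$ be the set of those $\{x_i\}\in\mathcal Q_{\mathcal F}$, with synthesis operator $X$, for which $(U^*U,X^*X)$ is a Fredholm pair of projections with index $j(U^*U,X^*X)=k$. Here a pair $(P,Q)$ of orthogonal projections is called Fredholm if $QP|_{\operatorname{ran}P}:\operatorname{ran}P\to\operatorname{ran}Q$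 is a Fredholm operator, and then its index is $j(P,Q)=\dim(\ker Q\cap\operatorname{ran}P)-\dim(\operatorname{ran}Q\cap\ker P)$. A member $\{y_i\}$ of a family $\mathcal Q$ of Parseval frames is called a symmetric approximation of $\{f_i\}$ in $\mathcal Q$ if $\sum_i\|f_i-y_i\|^2<\infty$ and $\sum_i\|f_i-y_i\|^2\le\sum_i\|f_i-x_i\|^2$ for all $\{x_i\}\in\mathcal Q$. Put $n_1=\dim\ker F$ and $n_3=\dim(\operatorname{ran}F)^\perp$ (possibly $\infty$), assume that $\dim\ker F>0$ and $\dim\mathcal K^\perp>0$, and let $k$ be an integer with $-\min\{n_1,n_3\}\le k\le -1$. Then: 1. For every partial isometry $S:\ker F\to(\operatorname{ran}F)^\perp$ of rank $-k$ and every $\{x_i\}\in\mathcal Q_{\mathcal F}^k$, $$\sum_{i}\|f_i-u_i-S(I-U^*U)e_i\|^2\le\sum_{i}\|f_i-x_i\|^2 .$$ 2. There are infinitely many symmetric approximations of $\{f_i\}$ in $\mathcal Q_{\mathcal F}^k$. 3. The symmetric approximations of $\{f_i\}$ in $\mathcal Q_{\mathcal F}^k$ are exactly the sequences $\{u_i+S(I-U^*U)e_i\}$,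 where $S:\ker F\to(\operatorname{ran}F)^\perp$ is a partial isometry of rank $-k$. -/

import Mathlib

open scoped ENNReal

noncomputable section

namespace FrameApprox

/-- The complex sequence space `ℓ²`. -/
abbrev Seq2 : Type := lp (fun _ : ℕ => ℂ) 2

/-- The standard basis `{e i}` of `ℓ²`. -/
def e (i : ℕ) : Seq2 := lp.single 2 i (1 : ℂ)

section PartialIsometries

variable {E G : Type*} [NormedAddCommGroup E] [InnerProductSpace ℂ E]
  [NormedAddCommGroup G] [InnerProductSpace ℂ G]

/-- A partial isometry: a bounded operator which is isometric on the orthogonal complement of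
its kernel. -/
def IsPartialIsometry (T : E →L[ℂ] G) : Prop :=
  ∀ x ∈ (LinearMap.ker T.toLinearMap)ᗮ, ‖T x‖ = ‖x‖

variable [CompleteSpace E] [CompleteSpace G]

/-- The modulus `|T| = (T* T)^{1/2}`. -/
def modulus (T : E →L[ℂ] G) : E →L[ℂ] E :=
  CFC.sqrt (ContinuousLinearMap.adjoint T ∘L T)

/-- `U` is the partial isometry in the polar decomposition `T = U |T|`. -/
structure IsPolarIsometry (T U : E →L[ℂ] G) : Prop where
  isPartialIsometry : IsPartialIsometry U
  eq_comp : T = U ∘L modulus T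
  ker_eq : LinearMap.ker U.toLinearMap = LinearMap.ker T.toLinearMap

theorem adjoint_comp_nonneg (T : E →L[ℂ] G) : 0 ≤ ContinuousLinearMap.adjoint T ∘L T := by
  rw [ContinuousLinearMap.nonneg_iff_isPositive]
  exact ContinuousLinearMap.isPositive_adjoint_comp_self T

theorem modulus_isSelfAdjoint (T : E →L[ℂ] G) :
    ContinuousLinearMap.adjoint (modulus T) = modulus T := by
  have h : IsSelfAdjoint (modulus T) := (CFC.sqrt_nonneg _).isSelfAdjoint
  exact h

theorem norm_modulus_apply (T : E →L[ℂ] G) (x : E) : ‖modulus T x‖ = ‖T x‖ := by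
  have h : modulus T * modulus T = ContinuousLinearMap.adjoint T ∘L T :=
    CFC.sqrt_mul_sqrt_self _ (adjoint_comp_nonneg T)
  have h1 : inner ℂ (modulus T x) (modulus T x) = inner ℂ (T x) (T x) := by
    rw [← ContinuousLinearMap.adjoint_inner_left, modulus_isSelfAdjoint,
      ← ContinuousLinearMap.adjoint_inner_left]
    exact congrArg (fun S : E →L[ℂ] E => inner ℂ (S x) x) h
  have h2 : ‖modulus T x‖ ^ 2 = ‖T x‖ ^ 2 := by
    rw [← inner_self_eq_norm_sq (𝕜 := ℂ), ← inner_self_eq_norm_sq (𝕜 := ℂ), h1]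
  exact (sq_eq_sq₀ (norm_nonneg _) (norm_nonneg _)).1 h2

theorem ker_modulus (T : E →L[ℂ] G) :
    LinearMap.ker (modulus T).toLinearMap = LinearMap.ker T.toLinearMap := by
  ext x
  have := norm_modulus_apply T x
  simp only [LinearMap.mem_ker, ContinuousLinearMap.coe_coe]
  rw [← norm_eq_zero, this, norm_eq_zero]

theorem range_modulus_orthogonal (T : E →L[ℂ] G) :
    (LinearMap.range (modulus T).toLinearMap)ᗮ = LinearMap.ker T.toLinearMap := by
  rw [← ker_modulus]
  have := ContinuousLinearMap.orthogonal_range (modulus T)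
  rw [modulus_isSelfAdjoint] at this
  exact this

theorem exists_isPolarIsometry (T : E →L[ℂ] G) : ∃ U, IsPolarIsometry T U := by
  set R : Submodule ℂ E := LinearMap.range (modulus T).toLinearMap with hR
  set M : Submodule ℂ E := R.topologicalClosure with hM
  have hMc : IsClosed (M : Set E) := R.isClosed_topologicalClosure
  have : CompleteSpace M := hMc.completeSpace_coe
  have hMo : Mᗮ = LinearMap.ker T.toLinearMap := by
    rw [hM, Submodule.orthogonal_closure, hR, range_modulus_orthogonal]
  have hmem : ∀ x, modulus T x ∈ M := fun x =>
    R.le_topologicalClosure ⟨x, rfl⟩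
  let j : E →ₗ[ℂ] M := (modulus T).toLinearMap.codRestrict M hmem
  have hd : DenseRange j := by
    intro y
    rw [Metric.mem_closure_iff]
    intro ε hε
    have hy : (y : E) ∈ closure (R : Set E) := y.2
    obtain ⟨z, ⟨x, rfl⟩, hz⟩ := Metric.mem_closure_iff.1 hy ε hε
    exact ⟨j x, ⟨x, rfl⟩, hz⟩
  have hn : ∀ x, ‖T.toLinearMap x‖ ≤ 1 * ‖j x‖ := fun x => by
    rw [one_mul]; exact (norm_modulus_apply T x).ge
  let W : M →L[ℂ] G := T.toLinearMap.extendOfNorm j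
  have hW : ∀ x, W (j x) = T x := LinearMap.extendOfNorm_eq hd ⟨1, hn⟩
  have hWn : ∀ y, ‖W y‖ = ‖y‖ := by
    have : (fun y => ‖W y‖) = fun y : M => ‖y‖ := by
      refine hd.equalizer (by fun_prop) (by fun_prop) ?_
      funext x
      simp only [Function.comp_apply, hW]
      exact (norm_modulus_apply T x).symm
    exact fun y => congrFun this y
  have hker : LinearMap.ker (W ∘L M.orthogonalProjectionOnto).toLinearMap
      = LinearMap.ker T.toLinearMap := by
    rw [← hMo]
    ext x
    simp only [LinearMap.mem_ker, ContinuousLinearMap.coe_coe, ContinuousLinearMap.comp_apply]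
    rw [← norm_eq_zero, hWn, norm_eq_zero]
    exact Submodule.orthogonalProjectionOnto_eq_zero_iff
  refine ⟨W ∘L M.orthogonalProjectionOnto, ?_, ?_, hker⟩
  · intro x hx
    rw [hker, ← hMo, Submodule.orthogonal_orthogonal] at hx
    rw [ContinuousLinearMap.comp_apply, hWn]
    have := Submodule.orthogonalProjectionOnto_mem_subspace_eq_self (K := M) ⟨x, hx⟩
    simp only at this
    rw [this]
    rfl
  · ext x
    have := Submodule.orthogonalProjectionOnto_mem_subspace_eq_self (K := M) (j x)
    change T x = W (M.orthogonalProjectionOnto (j x))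
    rw [this, hW]

theorem IsPolarIsometry.unique {T U V : E →L[ℂ] G} (hU : IsPolarIsometry T U)
    (hV : IsPolarIsometry T V) : U = V := by
  set D := U - V
  have h1 : LinearMap.range (modulus T).toLinearMap ≤ LinearMap.ker D.toLinearMap := by
    rintro _ ⟨x, rfl⟩
    have hu := congrArg (fun S : E →L[ℂ] G => S x) hU.eq_comp
    have hv := congrArg (fun S : E →L[ℂ] G => S x) hV.eq_comp
    simp only [ContinuousLinearMap.comp_apply] at hu hv
    simp [D, ← hu, ← hv]
  have h2 : (LinearMap.range (modulus T).toLinearMap)ᗮ ≤ LinearMap.ker D.toLinearMap := by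
    intro x hx
    rw [range_modulus_orthogonal] at hx
    have hu : x ∈ LinearMap.ker U.toLinearMap := hU.ker_eq ▸ hx
    have hv : x ∈ LinearMap.ker V.toLinearMap := hV.ker_eq ▸ hx
    simp only [LinearMap.mem_ker, ContinuousLinearMap.coe_coe] at hu hv
    simp [D, hu, hv]
  have hc : IsClosed (LinearMap.ker D.toLinearMap : Set E) := D.isClosed_ker
  have : CompleteSpace (LinearMap.ker D.toLinearMap) := hc.completeSpace_coe
  have h4 : (LinearMap.ker D.toLinearMap)ᗮ = ⊥ := by
    have a := Submodule.orthogonal_le h1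
    have b : (LinearMap.ker D.toLinearMap)ᗮ ≤ LinearMap.ker D.toLinearMap := a.trans h2
    rw [Submodule.eq_bot_iff]
    exact fun x hx => inner_self_eq_zero.1 ((Submodule.mem_orthogonal _ _).1 hx x (b hx))
  have h5 : LinearMap.ker D.toLinearMap = ⊤ := by
    rw [← Submodule.orthogonal_orthogonal (LinearMap.ker D.toLinearMap), h4,
      Submodule.bot_orthogonal_eq_top]
  have : D = 0 := by
    ext x
    have : x ∈ LinearMap.ker D.toLinearMap := h5 ▸ Submodule.mem_top
    simpa using this
  exact sub_eq_zero.1 this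

/-- The partial isometry `U` of the polar decomposition `T = U |T|`, `ker U = ker T`. -/
def polarIsometry (T : E →L[ℂ] G) : E →L[ℂ] G :=
  (exists_isPolarIsometry T).choose

theorem polarIsometry_spec (T : E →L[ℂ] G) : IsPolarIsometry T (polarIsometry T) :=
  (exists_isPolarIsometry T).choose_spec

theorem IsPartialIsometry.comp_adjoint_comp {T : E →L[ℂ] G} (h : IsPartialIsometry T) (x : E) :
    T (ContinuousLinearMap.adjoint T (T x)) = T x := by
  set N : Submodule ℂ E := LinearMap.ker T.toLinearMap with hN
  have hc : IsClosed (N : Set E) := T.isClosed_ker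
  have : CompleteSpace N := hc.completeSpace_coe
  obtain ⟨n, hn, m, hm, rfl⟩ := N.exists_add_mem_mem_orthogonal x
  have hTn : T n = 0 := hn
  have hnorm : ‖T‖ ≤ 1 := by
    refine T.opNorm_le_bound zero_le_one fun y => ?_
    obtain ⟨a, ha, b, hb, rfl⟩ := N.exists_add_mem_mem_orthogonal y
    have hTa : T a = 0 := ha
    have hab : inner ℂ a b = 0 := (Submodule.mem_orthogonal _ _).1 hb a ha
    rw [map_add, hTa, zero_add, h b hb, one_mul]
    have hp := norm_add_sq_eq_norm_sq_add_norm_sq_of_inner_eq_zero a b hab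
    nlinarith [norm_nonneg a, norm_nonneg b, norm_nonneg (a + b)]
  have hadj : ‖ContinuousLinearMap.adjoint T (T m)‖ ≤ ‖m‖ := by
    calc ‖ContinuousLinearMap.adjoint T (T m)‖
        ≤ ‖ContinuousLinearMap.adjoint T‖ * ‖T m‖ := ContinuousLinearMap.le_opNorm _ _
      _ ≤ 1 * ‖m‖ := by
        rw [h m hm, LinearIsometryEquiv.norm_map]
        gcongr
      _ = ‖m‖ := one_mul _
  have hfix : ContinuousLinearMap.adjoint T (T m) = m := by
    have h1 : RCLike.re (inner ℂ (ContinuousLinearMap.adjoint T (T m)) m) = ‖m‖ ^ 2 := by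
      rw [ContinuousLinearMap.adjoint_inner_left, inner_self_eq_norm_sq, h m hm]
    have h2 := norm_sub_sq (𝕜 := ℂ) (ContinuousLinearMap.adjoint T (T m)) m
    rw [h1] at h2
    have h3 : ‖ContinuousLinearMap.adjoint T (T m) - m‖ = 0 := by
      have := norm_nonneg (ContinuousLinearMap.adjoint T (T m))
      nlinarith [norm_nonneg (ContinuousLinearMap.adjoint T (T m) - m), norm_nonneg m]
    exact sub_eq_zero.1 (norm_eq_zero.1 h3)
  rw [map_add, hTn, zero_add, hfix]

/-- `I - U* U` maps into `ker T`, where `T = U |T|` is the polar decomposition. -/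
theorem sub_adjoint_comp_mem_ker (T : E →L[ℂ] G) (x : E) :
    (ContinuousLinearMap.id ℂ E
      - ContinuousLinearMap.adjoint (polarIsometry T) ∘L polarIsometry T) x
      ∈ LinearMap.ker T.toLinearMap := by
  rw [← (polarIsometry_spec T).ker_eq]
  simp [(polarIsometry_spec T).isPartialIsometry.comp_adjoint_comp x]

end PartialIsometries

section FredholmPairs

variable {E : Type*} [NormedAddCommGroup E] [InnerProductSpace ℂ E]

/-- The operator `QP|_{ran P} : ran P → ran Q`. -/
def pairOperator (P Q : E →L[ℂ] E) :
    LinearMap.range P.toLinearMap →L[ℂ] LinearMap.range Q.toLinearMap :=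
  ((Q ∘L P) ∘L (LinearMap.range P.toLinearMap).subtypeL).codRestrict
    (LinearMap.range Q.toLinearMap) (fun x => ⟨P x, rfl⟩)

/-- For orthogonal projections `P`, `Q`: the pair `(P, Q)` is Fredholm. -/
def IsFredholmPair (P Q : E →L[ℂ] E) : Prop :=
  (pairOperator P Q).IsFredholm

/-- The index `j(P, Q) = dim (ker Q ∩ ran P) - dim (ran Q ∩ ker P)` of a Fredholm pair of
orthogonal projections; both dimensions are finite for such a pair. -/
def pairIndex (P Q : E →L[ℂ] E) : ℤ :=
  (Module.finrank ℂ
    (LinearMap.ker Q.toLinearMap ⊓ LinearMap.range P.toLinearMap : Submodule ℂ E) : ℤ)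
  - (Module.finrank ℂ
    (LinearMap.range Q.toLinearMap ⊓ LinearMap.ker P.toLinearMap : Submodule ℂ E) : ℤ)

end FredholmPairs

/-- The dimension of a complex vector space, with value `∞` if it is not finite dimensional. -/
def dim (V : Type*) [AddCommGroup V] [Module ℂ V] : ℕ∞ :=
  Cardinal.toENat (Module.rank ℂ V)

section Frames

variable {H : Type*} [NormedAddCommGroup H] [InnerProductSpace ℂ H]

/-- `f` is a frame in the closed subspace `K`. -/
structure IsFrameIn (K : Submodule ℂ H) (f : ℕ → H) : Prop where
  isClosed : IsClosed (K : Set H)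
  mem : ∀ i, f i ∈ K
  bounds : ∃ A B : ℝ, 0 < A ∧ 0 < B ∧ ∀ g ∈ K,
    Summable (fun i => ‖inner ℂ (f i) g‖ ^ 2) ∧
    A * ‖g‖ ^ 2 ≤ ∑' i, ‖inner ℂ (f i) g‖ ^ 2 ∧
    ∑' i, ‖inner ℂ (f i) g‖ ^ 2 ≤ B * ‖g‖ ^ 2

/-- `x` is a Parseval frame in the closed subspace `L`. -/
structure IsParsevalFrameIn (L : Submodule ℂ H) (x : ℕ → H) : Prop where
  isClosed : IsClosed (L : Set H)
  mem : ∀ i, x i ∈ L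
  hasSum : ∀ g ∈ L, HasSum (fun i => ‖inner ℂ (x i) g‖ ^ 2) (‖g‖ ^ 2)

theorem IsParsevalFrameIn.isFrameIn {L : Submodule ℂ H} {x : ℕ → H}
    (h : IsParsevalFrameIn L x) : IsFrameIn L x where
  isClosed := h.isClosed
  mem := h.mem
  bounds := ⟨1, 1, one_pos, one_pos, fun g hg =>
    ⟨(h.hasSum g hg).summable, by rw [(h.hasSum g hg).tsum_eq, one_mul],
      by rw [(h.hasSum g hg).tsum_eq, one_mul]⟩⟩

variable [CompleteSpace H]

theorem IsFrameIn.exists_synthesis {K : Submodule ℂ H} {f : ℕ → H} (h : IsFrameIn K f) :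
    ∃ T : Seq2 →L[ℂ] H, ∀ i, T (e i) = f i := by
  obtain ⟨A, B, -, hB, hb⟩ := h.bounds
  have : CompleteSpace K := h.isClosed.completeSpace_coe
  have hmem : ∀ g : K, Memℓp (fun i => inner ℂ (f i) (g : H)) 2 := fun g => by
    rw [memℓp_gen_iff (by norm_num)]
    simpa using (hb g g.2).1
  let T0 : K →ₗ[ℂ] Seq2 :=
    { toFun := fun g => ⟨fun i => inner ℂ (f i) (g : H), hmem g⟩
      map_add' := fun g g' => by
        ext i
        exact inner_add_right _ _ _
      map_smul' := fun c g => by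
        ext i
        exact inner_smul_right _ _ _ }
  let T1 : K →L[ℂ] Seq2 := T0.mkContinuous (Real.sqrt B) (fun g => by
    have h1 : ‖T0 g‖ ^ 2 = ∑' i, ‖inner ℂ (f i) (g : H)‖ ^ 2 := by
      have := lp.norm_rpow_eq_tsum (p := 2) (by norm_num) (T0 g)
      simpa [T0] using this
    have h2 := (hb g g.2).2.2
    rw [← h1] at h2
    have h3 : ‖T0 g‖ ^ 2 ≤ (Real.sqrt B * ‖g‖) ^ 2 := by
      rw [mul_pow, Real.sq_sqrt hB.le]
      exact h2
    exact (sq_le_sq₀ (norm_nonneg _) (by positivity)).1 h3)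
  refine ⟨K.subtypeL ∘L ContinuousLinearMap.adjoint T1, fun i => ?_⟩
  have h4 : ContinuousLinearMap.adjoint T1 (e i) = ⟨f i, h.mem i⟩ := by
    refine ext_inner_right ℂ fun g => ?_
    rw [ContinuousLinearMap.adjoint_inner_left, e, lp.inner_single_left]
    simp [T1, T0]
  simp [h4]

open Classical in
/-- The synthesis operator of a sequence `f`: the bounded operator `ℓ² → H` with `e i ↦ f i`
(it exists if `f` is a frame in a subspace, and it is set to `0` if it does not exist). -/
def synthesis (f : ℕ → H) : Seq2 →L[ℂ] H :=
  if h : ∃ T : Seq2 →L[ℂ] H, ∀ i, T (e i) = f i then h.choose else 0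

theorem IsFrameIn.synthesis_apply {K : Submodule ℂ H} {f : ℕ → H} (h : IsFrameIn K f) (i : ℕ) :
    synthesis f (e i) = f i := by
  rw [synthesis, dif_pos h.exists_synthesis]
  exact h.exists_synthesis.choose_spec i

/-- The canonical Parseval frame `u i = U (e i)`, where `F = U |F|` is the polar decomposition of
the synthesis operator `F` of `f`. -/
def canonicalParseval (f : ℕ → H) (i : ℕ) : H :=
  polarIsometry (synthesis f) (e i)

/-- The squared `ℓ²`-distance `∑ ‖f i - x i‖²`, possibly infinite. -/
def sqDist (f x : ℕ → H) : ℝ≥0∞ :=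
  ∑' i, ‖f i - x i‖ₑ ^ 2

/-- `𝒬_ℱ`: the Parseval frames in closed subspaces of `H` which are quadratically close to `f`. -/
def closeParseval (f : ℕ → H) : Set (ℕ → H) :=
  {x | (∃ L : Submodule ℂ H, IsParsevalFrameIn L x) ∧ sqDist x f < ∞}

/-- `𝒬_ℱ^k`: the `x ∈ 𝒬_ℱ` with `j(U* U, X* X) = k`, where `X` is the synthesis operator of `x`
and `F = U |F|` is the polar decomposition of the synthesis operator `F` of `f`. -/
def closeParsevalIndex (f : ℕ → H) (k : ℤ) : Set (ℕ → H) :=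
  {x | x ∈ closeParseval f ∧
    IsFredholmPair
      (ContinuousLinearMap.adjoint (polarIsometry (synthesis f)) ∘L polarIsometry (synthesis f))
      (ContinuousLinearMap.adjoint (synthesis x) ∘L synthesis x) ∧
    pairIndex
      (ContinuousLinearMap.adjoint (polarIsometry (synthesis f)) ∘L polarIsometry (synthesis f))
      (ContinuousLinearMap.adjoint (synthesis x) ∘L synthesis x) = k}

/-- `y` is a symmetric approximation of `f` in the family `Q`. -/
def IsSymmetricApproximation (f : ℕ → H) (Q : Set (ℕ → H)) (y : ℕ → H) : Prop :=
  y ∈ Q ∧ sqDist f y < ∞ ∧ ∀ x ∈ Q, sqDist f y ≤ sqDist f x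

/-- The sequence `u i + S (I - U* U) (e i)`, for an operator `S : ker F → (ran F)ᗮ`. -/
def perturbedCanonical (f : ℕ → H)
    (S : LinearMap.ker (synthesis f).toLinearMap →L[ℂ]
      (LinearMap.range (synthesis f).toLinearMap)ᗮ) (i : ℕ) : H :=
  canonicalParseval f i +
    S ⟨(ContinuousLinearMap.id ℂ Seq2
        - ContinuousLinearMap.adjoint (polarIsometry (synthesis f))
          ∘L polarIsometry (synthesis f)) (e i),
      sub_adjoint_comp_mem_ker (synthesis f) (e i)⟩

end Frames

end FrameApprox

end

/-! Write `F` for the synthesis operator, `U` for its polar isometry, `P = U*U`. Synthesis operators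
of Parseval frames in closed subspaces are exactly the partial isometries `X : ℓ² → H`, and `∑ ‖f i
- x i‖²` is the squared Hilbert-Schmidt norm `‖F - X‖²`, so the problem concerns partial isometries
near `F`. Put `Q = X*X`.

The heart is the identity `‖F - X‖² = ‖F - U‖² + n + R` for `X` of index `-n`, where `R ≥ 0`
vanishes exactly when `XP = U` (`exists_hsSq_sub_eq`). Off `ran P` the operator `F` is zero and `X`
contributes `‖(1-P)Q‖²`. On `ran P` the self-adjoint operator `|F| - P` is Hilbert-Schmidt, hence
compact, and is diagonalised; on an eigenvector an elementary expansion compares `F - X` with `F -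
U` at the cost of `‖(1-Q)P‖²` and a nonnegative remainder (`exists_hsSq_sub_add_eq`). The two
projection terms combine by the trace formula `j(P,Q) = ‖(1-Q)P‖² - ‖(1-P)Q‖²`
(`hsSq_add_finrank_eq`), obtained from the polar decomposition of `QP`. Finiteness of `‖F - U‖`
follows from a single close Parseval frame together with the lower frame bound
(`hsSq_sub_initial_ne_top`).

Equality therefore means that `X` extends `U` from `ran P`. Such an `X` is `U` plus a partial
isometry `S` from `ker F` to `(ran F)ᗮ`, and conversely every such sum is a partial isometry; the
index forces the rank of `S` to be `n` (`exists_isPartialIsometry_of_agree`,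
`isPartialIsometry_of_extends`, `pairIndex_eq_neg_finrank`). Multiplying `S ≠ 0` by unimodular
scalars produces infinitely many minimisers. -/

namespace FrameApprox

universe u

set_option linter.unusedSectionVars false

/-! ### Hilbert-Schmidt norms with values in `[0, ∞]`, and the spectral theorem for compact
symmetric operators. -/

section HilbertSchmidt

variable {E G L : Type*} [NormedAddCommGroup E] [InnerProductSpace ℂ E] [CompleteSpace E]
  [NormedAddCommGroup G] [InnerProductSpace ℂ G] [CompleteSpace G]
  [NormedAddCommGroup L] [InnerProductSpace ℂ L] [CompleteSpace L]
  {ι κ : Type*}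

theorem enorm_sq_eq_ofReal {V : Type*} [NormedAddCommGroup V] (v : V) :
    ‖v‖ₑ ^ 2 = ENNReal.ofReal (‖v‖ ^ 2) := by
  rw [ENNReal.ofReal_pow (norm_nonneg _), ofReal_norm]

theorem hasSum_norm_inner_sq (b : HilbertBasis ι ℂ E) (x : E) :
    HasSum (fun i => ‖inner ℂ (b i) x‖ ^ 2) (‖x‖ ^ 2) := by
  have h := Complex.hasSum_re (b.hasSum_inner_mul_inner x x)
  rw [show (inner ℂ x x).re = ‖x‖ ^ 2 from inner_self_eq_norm_sq (𝕜 := ℂ) x] at h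
  refine h.congr_fun fun i => ?_
  rw [← inner_conj_symm x, ← Complex.normSq_eq_conj_mul_self, Complex.ofReal_re,
    Complex.normSq_eq_norm_sq]

theorem enorm_sq_eq_tsum_inner (b : HilbertBasis ι ℂ E) (x : E) :
    ‖x‖ₑ ^ 2 = ∑' i, ‖inner ℂ (b i) x‖ₑ ^ 2 := by
  have h' := hasSum_norm_inner_sq b x
  rw [enorm_sq_eq_ofReal, ← h'.tsum_eq,
    ENNReal.ofReal_tsum_of_nonneg (fun i => by positivity) h'.summable]
  simp only [enorm_sq_eq_ofReal]

/-- Parseval turns both sides into the double sum of the squared matrix entries; in `[0, ∞]` the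
order of summation is free. -/
theorem tsum_enorm_sq_adjoint (b : HilbertBasis ι ℂ E) (c : HilbertBasis κ ℂ G) (T : E →L[ℂ] G) :
    ∑' i, ‖T (b i)‖ₑ ^ 2 = ∑' j, ‖ContinuousLinearMap.adjoint T (c j)‖ₑ ^ 2 := by
  simp_rw [enorm_sq_eq_tsum_inner c, enorm_sq_eq_tsum_inner b]
  rw [ENNReal.tsum_comm]
  congr! 5 with j i
  rw [ContinuousLinearMap.adjoint_inner_right, ← inner_conj_symm, ← ofReal_norm, ← ofReal_norm,
    RCLike.norm_conj]

/-- The squared Hilbert-Schmidt norm, with values in `[0, ∞]`. -/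
noncomputable def hsSq (T : E →L[ℂ] G) : ℝ≥0∞ :=
  ∑' i : (exists_hilbertBasis ℂ E).choose, ‖T i‖ₑ ^ 2

/-- Any two bases of the domain give the same sum for the adjoint over one fixed basis of the
target. -/
theorem hsSq_eq (b : HilbertBasis ι ℂ E) (T : E →L[ℂ] G) : hsSq T = ∑' i, ‖T (b i)‖ₑ ^ 2 := by
  obtain ⟨w, c, -⟩ := exists_hilbertBasis ℂ G
  have h := (exists_hilbertBasis ℂ E).choose_spec
  obtain ⟨b', hb'⟩ := h
  rw [tsum_enorm_sq_adjoint b c, ← tsum_enorm_sq_adjoint b' c, hb', hsSq]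

theorem hsSq_adjoint (T : E →L[ℂ] G) : hsSq (ContinuousLinearMap.adjoint T) = hsSq T := by
  obtain ⟨w, b, -⟩ := exists_hilbertBasis ℂ E
  obtain ⟨w, c, -⟩ := exists_hilbertBasis ℂ G
  rw [hsSq_eq b, hsSq_eq c, tsum_enorm_sq_adjoint b c]

theorem hsSq_congr {S : E →L[ℂ] G} {T : E →L[ℂ] L} (h : ∀ x, ‖S x‖ = ‖T x‖) :
    hsSq S = hsSq T := by
  simp only [hsSq, ← ofReal_norm, h]

theorem hsSq_le_of_norm_le {S : E →L[ℂ] G} {T : E →L[ℂ] L} {C : ℝ} (hC : 0 ≤ C)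
    (h : ∀ x, ‖S x‖ ≤ C * ‖T x‖) : hsSq S ≤ ENNReal.ofReal C ^ 2 * hsSq T := by
  simp only [hsSq, ← ENNReal.tsum_mul_left, ← mul_pow]
  refine ENNReal.tsum_le_tsum fun i => ?_
  gcongr
  rw [← ofReal_norm, ← ofReal_norm, ← ENNReal.ofReal_mul hC]
  exact ENNReal.ofReal_le_ofReal (h i)

theorem hsSq_ne_top_of_norm_le {S : E →L[ℂ] G} {T : E →L[ℂ] L} {C : ℝ} (hC : 0 ≤ C)
    (h : ∀ x, ‖S x‖ ≤ C * ‖T x‖) (hT : hsSq T ≠ ∞) : hsSq S ≠ ∞ :=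
  ne_top_of_le_ne_top (ENNReal.mul_ne_top (by simp) hT) (hsSq_le_of_norm_le hC h)

theorem hsSq_comp_left_ne_top (S : G →L[ℂ] L) {T : E →L[ℂ] G} (hT : hsSq T ≠ ∞) :
    hsSq (S ∘L T) ≠ ∞ :=
  hsSq_ne_top_of_norm_le (norm_nonneg S) (fun x => S.le_opNorm (T x)) hT

theorem hsSq_comp_right_ne_top {S : G →L[ℂ] L} (T : E →L[ℂ] G) (hS : hsSq S ≠ ∞) :
    hsSq (S ∘L T) ≠ ∞ := by
  rw [← hsSq_adjoint, ContinuousLinearMap.adjoint_comp]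
  exact hsSq_comp_left_ne_top _ (by rwa [hsSq_adjoint])

theorem hsSq_neg (T : E →L[ℂ] G) : hsSq (-T) = hsSq T := hsSq_congr fun x => by simp

theorem hsSq_eq_add {T : E →L[ℂ] G} {A : E →L[ℂ] L} {M : Type*} [NormedAddCommGroup M]
    [InnerProductSpace ℂ M] {B : E →L[ℂ] M}
    (h : ∀ x, ‖T x‖ ^ 2 = ‖A x‖ ^ 2 + ‖B x‖ ^ 2) : hsSq T = hsSq A + hsSq B := by
  simp only [hsSq, ← ENNReal.tsum_add]
  congr! 2 with i
  simp only [← ofReal_norm, ← ENNReal.ofReal_pow (norm_nonneg _)]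
  rw [h, ENNReal.ofReal_add (by positivity) (by positivity)]

theorem hsSq_add_ne_top {S T : E →L[ℂ] G} (hS : hsSq S ≠ ∞) (hT : hsSq T ≠ ∞) :
    hsSq (S + T) ≠ ∞ := by
  have h : hsSq (S + T) ≤ 2 * hsSq S + 2 * hsSq T := by
    simp only [hsSq, ← ENNReal.tsum_mul_left, ← ENNReal.tsum_add]
    refine ENNReal.tsum_le_tsum fun i => ?_
    rw [add_apply]
    simp only [← ofReal_norm, ← ENNReal.ofReal_pow (norm_nonneg _)]
    rw [show (2 : ℝ≥0∞) = ENNReal.ofReal 2 by simp, ← ENNReal.ofReal_mul (by norm_num),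
      ← ENNReal.ofReal_mul (by norm_num), ← ENNReal.ofReal_add (by positivity) (by positivity)]
    refine ENNReal.ofReal_le_ofReal ?_
    have := norm_add_le (S i) (T i)
    nlinarith [norm_nonneg (S i + T i), sq_nonneg (‖S i‖ - ‖T i‖), norm_nonneg (S i),
      norm_nonneg (T i)]
  exact ne_top_of_le_ne_top (by finiteness) h

theorem hsSq_sub_ne_top {S T : E →L[ℂ] G} (hS : hsSq S ≠ ∞) (hT : hsSq T ≠ ∞) :
    hsSq (S - T) ≠ ∞ := by
  rw [sub_eq_add_neg]
  exact hsSq_add_ne_top hS (by rwa [hsSq_neg])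

theorem hsSq_subtypeL (N : Submodule ℂ E) [CompleteSpace N] [FiniteDimensional ℂ N] :
    hsSq N.subtypeL = Module.finrank ℂ N := by
  rw [hsSq_eq (stdOrthonormalBasis ℂ N).toHilbertBasis]
  have h : ∀ i, ‖N.subtypeL (stdOrthonormalBasis ℂ N i)‖ₑ ^ 2 = 1 := fun i => by
    have : ‖stdOrthonormalBasis ℂ N i‖ = 1 := (stdOrthonormalBasis ℂ N).orthonormal.1 i
    rw [Submodule.coe_norm] at this
    rw [enorm_sq_eq_ofReal, Submodule.subtypeL_apply, this]
    simp
  rw [OrthonormalBasis.coe_toHilbertBasis]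
  simp_rw [h]
  simp

theorem finiteDimensional_of_hsSq_subtypeL (N : Submodule ℂ E) [CompleteSpace N]
    (h : hsSq N.subtypeL ≠ ∞) : FiniteDimensional ℂ N := by
  obtain ⟨w, b, -⟩ := exists_hilbertBasis ℂ N
  have hw : Finite w := by
    have : ∑' i : w, (1 : ℝ≥0∞) ≠ ∞ := by
      rw [hsSq_eq b] at h
      convert h with i
      have : ‖b i‖ = 1 := b.orthonormal.1 i
      rw [Submodule.coe_norm] at this
      simp [enorm_sq_eq_ofReal, this]
    by_contra hw
    rw [not_finite_iff_infinite] at hw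
    exact this (ENNReal.tsum_const_eq_top_of_ne_zero one_ne_zero)
  have := Fintype.ofFinite w
  exact b.toOrthonormalBasis.toBasis.finiteDimensional_of_finite

theorem hsSq_starProjection (N : Submodule ℂ E) [CompleteSpace N] :
    hsSq N.starProjection = hsSq N.subtypeL := by
  rw [← hsSq_adjoint N.subtypeL]
  refine hsSq_congr fun x => ?_
  rw [Submodule.adjoint_subtypeL]
  rfl

/-- The finite-rank truncations `A s` of `T` to finitely many target coordinates converge in
operator norm, because the squared error is bounded by a tail of the convergent sum for the adjoint.
-/
theorem isCompactOperator_of_hsSq_ne_top {T : E →L[ℂ] G} (h : hsSq T ≠ ∞) :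
    IsCompactOperator T := by
  obtain ⟨w, b, -⟩ := exists_hilbertBasis ℂ G
  rw [← hsSq_adjoint, hsSq_eq b] at h
  let A : Finset w → E →L[ℂ] G := fun s =>
    ∑ i ∈ s, (InnerProductSpace.toDual ℂ E (ContinuousLinearMap.adjoint T (b i))).smulRight (b i)
  have hA : ∀ s x, A s x = ∑ i ∈ s, inner ℂ (b i) (T x) • b i := fun s x => by
    simp [A, sum_apply, ContinuousLinearMap.adjoint_inner_left]
  have hbound : ∀ s x, ‖T x - A s x‖ₑ ^ 2
      ≤ (∑' i : { i // i ∉ s }, ‖ContinuousLinearMap.adjoint T (b i)‖ₑ ^ 2) * ‖x‖ₑ ^ 2 := by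
    intro s x
    rw [enorm_sq_eq_tsum_inner b, ← ENNReal.tsum_mul_right,
      ← tsum_subtype_eq_of_support_subset (s := {i | i ∉ s})]
    · refine ENNReal.tsum_le_tsum fun i => ?_
      rw [← mul_pow]
      gcongr
      have h0 : inner ℂ (b i) (A s x) = 0 := by
        rw [hA, inner_sum]
        refine Finset.sum_eq_zero fun j hj => ?_
        rw [inner_smul_right, b.orthonormal.2 (fun h => i.2 (by rw [h]; exact hj)), mul_zero]
      rw [inner_sub_right, h0, sub_zero, ← ContinuousLinearMap.adjoint_inner_left]
      rw [← ofReal_norm, ← ofReal_norm, ← ofReal_norm,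
        ← ENNReal.ofReal_mul (norm_nonneg _)]
      exact ENNReal.ofReal_le_ofReal (norm_inner_le_norm _ _)
    · intro i hi
      by_contra his
      apply hi
      have his : i ∈ s := by simpa using his
      change ‖inner ℂ (b i) (T x - A s x)‖ₑ ^ 2 = 0
      rw [inner_sub_right, hA, b.orthonormal.inner_right_sum _ his]
      simp
  refine isCompactOperator_of_tendsto (l := Filter.atTop) (F := A) ?_ (.of_forall fun s => ?_)
  · rw [tendsto_iff_norm_sub_tendsto_zero]
    have ht := ENNReal.tendsto_tsum_compl_atTop_zero h
    have ht2 : Filter.Tendsto (fun s : Finset w => Real.sqrt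
        (∑' i : { i // i ∉ s }, ‖ContinuousLinearMap.adjoint T (b i)‖ₑ ^ 2).toReal)
        Filter.atTop (nhds 0) := by
      have := (Real.continuous_sqrt.tendsto 0).comp
        ((ENNReal.tendsto_toReal ENNReal.zero_ne_top).comp ht)
      rw [Real.sqrt_zero] at this
      exact this
    refine squeeze_zero (fun _ => norm_nonneg _) (fun s => ?_) ht2
    refine ContinuousLinearMap.opNorm_le_bound _ (Real.sqrt_nonneg _) fun x => ?_
    have hfin : (∑' i : { i // i ∉ s }, ‖ContinuousLinearMap.adjoint T (b i)‖ₑ ^ 2) ≠ ∞ :=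
      ne_top_of_le_ne_top h (ENNReal.tsum_comp_le_tsum_of_injective Subtype.val_injective _)
    have hb := ENNReal.toReal_mono (by finiteness) (hbound s x)
    rw [ENNReal.toReal_mul, ENNReal.toReal_pow, ENNReal.toReal_pow, toReal_enorm,
      toReal_enorm] at hb
    rw [sub_apply, norm_sub_rev]
    refine (sq_le_sq₀ (norm_nonneg _) (by positivity)).1 ?_
    rw [mul_pow, Real.sq_sqrt ENNReal.toReal_nonneg]
    exact hb
  · have : A s ∈ compactOperator (RingHom.id ℂ) E G := by
      refine Submodule.sum_mem _ fun i _ => ?_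
      exact (isCompactOperator_of_locallyCompactSpace_dom
        (InnerProductSpace.toDual ℂ E (ContinuousLinearMap.adjoint T (b i)))).clm_comp (ContinuousLinearMap.toSpanSingleton ℂ (b i))
    exact this

/-- A compact symmetric operator has an orthonormal basis of eigenvectors. -/
theorem exists_hilbertBasis_eigenvectors {E : Type u} [NormedAddCommGroup E]
    [InnerProductSpace ℂ E] [CompleteSpace E] {T : E →L[ℂ] E} (hc : IsCompactOperator T)
    (hs : T.toLinearMap.IsSymmetric) :
    ∃ (ι : Type u) (b : HilbertBasis ι ℂ E), ∀ i, ∃ μ : ℂ, T (b i) = μ • b i := by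
  have hcl : ∀ μ : ℂ, CompleteSpace (Module.End.eigenspace T.toLinearMap μ) := fun μ => by
    have : IsClosed (Module.End.eigenspace T.toLinearMap μ : Set E) := by
      have h : (Module.End.eigenspace T.toLinearMap μ : Set E)
          = (fun x => T x - μ • x) ⁻¹' {0} := by
        ext x
        simp [sub_eq_zero]
      rw [h]
      exact isClosed_singleton.preimage (by fun_prop)
    exact this.completeSpace_coe
  -- Bases of all eigenspaces are glued, with every `μ : ℂ` as an index and `0` included; those `μ`
  -- that are not eigenvalues contribute nothing.
  choose w c _ using fun μ : ℂ =>
    exists_hilbertBasis ℂ (Module.End.eigenspace T.toLinearMap μ)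
  have ho := hs.orthogonalFamily_eigenspaces.orthonormal_sigma_orthonormal
    (v_family := fun μ => c μ) (fun μ => (c μ).orthonormal)
  refine ⟨Σ μ : ℂ, w μ, HilbertBasis.mkOfOrthogonalEqBot ho ?_, fun i => ⟨i.1, ?_⟩⟩
  · rw [← le_bot_iff, ← ContinuousLinearMap.orthogonalComplement_iSup_eigenspaces_eq_bot hc hs]
    rw [← Submodule.iInf_orthogonal]
    refine le_iInf fun μ x hx => ?_
    rw [Submodule.mem_orthogonal']
    intro y hy
    have h1 := (c μ).hasSum_repr ⟨y, hy⟩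
    have h2 : HasSum (fun i => (c μ).repr ⟨y, hy⟩ i • (c μ i : E)) y := by
      simpa using (Module.End.eigenspace T.toLinearMap μ).subtypeL.hasSum h1
    have h3 := (innerSL ℂ x).hasSum h2
    refine h3.unique ?_
    convert! hasSum_zero with i
    have h4 : inner ℂ x (c μ i : E) = 0 :=
      (Submodule.mem_orthogonal' _ _).1 hx _ (Submodule.subset_span ⟨⟨μ, i⟩, rfl⟩)
    simp only [innerSL_apply_apply, inner_smul_right, h4, mul_zero]
  · rw [HilbertBasis.coe_mkOfOrthogonalEqBot]
    exact Module.End.mem_eigenspace_iff.1 (c i.1 i.2).2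

end HilbertSchmidt

/-! ### Pairs of orthogonal projections: the index as a difference of squared Hilbert-Schmidt norms.
-/

section Projections

variable {E G : Type*} [NormedAddCommGroup E] [InnerProductSpace ℂ E] [CompleteSpace E]
  [NormedAddCommGroup G] [InnerProductSpace ℂ G] [CompleteSpace G]

theorem _root_.IsStarProjection.adjoint_eq {P : E →L[ℂ] E} (hP : IsStarProjection P) :
    ContinuousLinearMap.adjoint P = P :=
  hP.isSelfAdjoint

theorem _root_.IsStarProjection.apply_apply {P : E →L[ℂ] E} (hP : IsStarProjection P) (x : E) :
    P (P x) = P x :=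
  congrArg (fun T : E →L[ℂ] E => T x) hP.isIdempotentElem

theorem _root_.IsStarProjection.inner_left {P : E →L[ℂ] E} (hP : IsStarProjection P) (x y : E) :
    inner ℂ (P x) y = inner ℂ x (P y) := by
  conv_lhs => rw [← hP.adjoint_eq]
  exact ContinuousLinearMap.adjoint_inner_left _ _ _

theorem _root_.IsStarProjection.norm_sq_eq {P : E →L[ℂ] E} (hP : IsStarProjection P) (x : E) :
    ‖x‖ ^ 2 = ‖P x‖ ^ 2 + ‖x - P x‖ ^ 2 := by
  have h : inner ℂ (P x) (x - P x) = 0 := by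
    rw [hP.inner_left, map_sub, hP.apply_apply, sub_self, inner_zero_right]
  have := norm_add_sq_eq_norm_sq_add_norm_sq_of_inner_eq_zero (P x) (x - P x) h
  rw [add_sub_cancel] at this
  nlinarith

theorem _root_.IsStarProjection.mem_range_iff {P : E →L[ℂ] E} (hP : IsStarProjection P) {x : E} :
    x ∈ LinearMap.range P.toLinearMap ↔ P x = x :=
  ⟨by rintro ⟨y, rfl⟩; exact hP.apply_apply y, fun h => ⟨x, h⟩⟩

theorem _root_.IsStarProjection.isClosed_range {P : E →L[ℂ] E} (hP : IsStarProjection P) :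
    IsClosed (LinearMap.range P.toLinearMap : Set E) := by
  have : (LinearMap.range P.toLinearMap : Set E) = {x | P x = x} := by
    ext x
    exact hP.mem_range_iff
  rw [this]
  exact isClosed_eq P.continuous continuous_id

theorem IsPartialIsometry.isStarProjection {T : E →L[ℂ] G} (h : IsPartialIsometry T) :
    IsStarProjection (ContinuousLinearMap.adjoint T ∘L T) where
  isIdempotentElem := by
    ext x
    change ContinuousLinearMap.adjoint T (T (ContinuousLinearMap.adjoint T (T x))) = _
    rw [h.comp_adjoint_comp]
    rfl
  isSelfAdjoint := (adjoint_comp_nonneg T).isSelfAdjoint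

theorem adjoint_comp_adjoint_of_comp_adjoint_comp {T : E →L[ℂ] G}
    (h : ∀ x, T (ContinuousLinearMap.adjoint T (T x)) = T x) (y : G) :
    ContinuousLinearMap.adjoint T (T (ContinuousLinearMap.adjoint T y))
      = ContinuousLinearMap.adjoint T y := by
  refine ext_inner_right ℂ fun x => ?_
  simp only [ContinuousLinearMap.adjoint_inner_left]
  rw [← ContinuousLinearMap.adjoint_inner_right, ContinuousLinearMap.adjoint_inner_left, h]

theorem norm_adjoint_comp_apply {T : E →L[ℂ] G}
    (h : ∀ x, T (ContinuousLinearMap.adjoint T (T x)) = T x) (x : E) :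
    ‖ContinuousLinearMap.adjoint T (T x)‖ = ‖T x‖ := by
  have h1 : ‖ContinuousLinearMap.adjoint T (T x)‖ ^ 2 = ‖T x‖ ^ 2 := by
    rw [← inner_self_eq_norm_sq (𝕜 := ℂ), ← inner_self_eq_norm_sq (𝕜 := ℂ),
      ContinuousLinearMap.adjoint_inner_left, h]
  exact (sq_eq_sq₀ (norm_nonneg _) (norm_nonneg _)).1 h1

theorem completeSpace_inf_ker_range {P Q : E →L[ℂ] E} (hP : IsStarProjection P) :
    CompleteSpace (LinearMap.ker Q.toLinearMap ⊓ LinearMap.range P.toLinearMap : Submodule ℂ E) :=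
  (show IsClosed ((LinearMap.ker Q.toLinearMap ⊓ LinearMap.range P.toLinearMap : Submodule ℂ E)
    : Set E) from Q.isClosed_ker.inter hP.isClosed_range).completeSpace_coe

/-- With `W = V*V` the projection onto the complement of `ker QP`, the range of `P` is the
orthogonal sum of `N = ker Q ∩ ran P` and `ran W`, and `1 - Q` is the identity on `N`. Only the
kernel of `V` is prescribed, so that the lemma also applies to `V*` with `P` and `Q` exchanged. -/
theorem hsSq_compl_comp_eq {P Q V : E →L[ℂ] E} (hP : IsStarProjection P) (hQ : IsStarProjection Q)
    (hV : ∀ x, V (ContinuousLinearMap.adjoint V (V x)) = V x) (hker : ∀ x, V x = 0 ↔ Q (P x) = 0)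
    [CompleteSpace
      (LinearMap.ker Q.toLinearMap ⊓ LinearMap.range P.toLinearMap : Submodule ℂ E)] :
    hsSq ((1 - Q) ∘L P) = hsSq (LinearMap.ker Q.toLinearMap ⊓ LinearMap.range P.toLinearMap :
      Submodule ℂ E).subtypeL + hsSq ((1 - Q) ∘L (ContinuousLinearMap.adjoint V ∘L V)) := by
  set N : Submodule ℂ E := LinearMap.ker Q.toLinearMap ⊓ LinearMap.range P.toLinearMap with hN
  set W := ContinuousLinearMap.adjoint V ∘L V with hW
  have hWs : ∀ x y, inner ℂ (W x) y = inner ℂ x (W y) := fun x y => by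
    simp only [hW, ContinuousLinearMap.comp_apply, ContinuousLinearMap.adjoint_inner_left,
      ContinuousLinearMap.adjoint_inner_right]
  have hWa : ContinuousLinearMap.adjoint W = W := by
    rw [hW, ContinuousLinearMap.adjoint_comp, ContinuousLinearMap.adjoint_adjoint]
  have hWP : ∀ x, W (P x) = W x := fun x => by
    have : V (x - P x) = 0 := by rw [hker, map_sub, hP.apply_apply, sub_self, map_zero]
    rw [map_sub, sub_eq_zero] at this
    simp [hW, this]
  have hPW : ∀ x, P (W x) = W x := fun x => by
    refine ext_inner_right ℂ fun y => ?_
    rw [hP.inner_left, hWs, hWP, hWs]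
  have hNW : ∀ n ∈ N, W n = 0 := by
    intro n hn
    have h1 : Q n = 0 := hn.1
    have h2 : P n = n := hP.mem_range_iff.1 hn.2
    have : V n = 0 := by rw [hker, h2, h1]
    simp [hW, this]
  have hmem : ∀ y, P y = y → y - W y ∈ N := by
    intro y hy
    have hz : V (y - W y) = 0 := by rw [map_sub, sub_eq_zero]; exact (hV y).symm
    rw [hker, map_sub, hy, hPW] at hz
    exact ⟨hz, hP.mem_range_iff.2 (by rw [map_sub, hy, hPW])⟩
  have hproj : ∀ y, P y = y → N.starProjection y = y - W y := by
    intro y hy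
    refine Submodule.eq_starProjection_of_mem_of_inner_eq_zero (hmem y hy) fun n hn => ?_
    rw [sub_sub_cancel, hWs, hNW n hn, inner_zero_right]
  have hNs := isStarProjection_starProjection (U := N)
  -- Pythagoras applies to values, so the splitting of `ran P` is used after passing to the adjoint.
  have hadj : hsSq ((1 - Q) ∘L P) = hsSq (P ∘L (1 - Q)) := by
    rw [← hsSq_adjoint, ContinuousLinearMap.adjoint_comp, hP.adjoint_eq, hQ.one_sub.adjoint_eq]
  have hpy := hsSq_eq_add (T := P ∘L (1 - Q)) (A := N.starProjection ∘L P ∘L (1 - Q))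
    (B := W ∘L P ∘L (1 - Q)) (fun x => by
      have h1 := hproj (P ((1 - Q) x)) (hP.apply_apply _)
      have h2 := hNs.norm_sq_eq (P ((1 - Q) x))
      simp only [ContinuousLinearMap.comp_apply]
      rw [h2, h1, sub_sub_cancel])
  rw [hadj, hpy, ← hsSq_starProjection N]
  congr 1
  · rw [← hsSq_adjoint]
    congr 1
    rw [ContinuousLinearMap.adjoint_comp, ContinuousLinearMap.adjoint_comp, hP.adjoint_eq,
      hQ.one_sub.adjoint_eq, hNs.adjoint_eq]
    ext x
    have hx : N.starProjection x ∈ N := Submodule.starProjection_apply_mem N x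
    have h1 : Q (N.starProjection x) = 0 := hx.1
    simp [hP.mem_range_iff.1 hx.2, h1]
  · rw [← hsSq_adjoint]
    congr 1
    rw [ContinuousLinearMap.adjoint_comp, ContinuousLinearMap.adjoint_comp, hP.adjoint_eq,
      hQ.one_sub.adjoint_eq, hWa]
    ext x
    simp [hPW]

/-- On generic position parts the pair is symmetric: `P V x = |QP| V*V x` has the norm of `Q V*V x`,
so by Pythagoras the defects of `V*V x` from `ran Q` and of `V x` from `ran P` agree. -/
theorem hsSq_compl_comp_initial_eq_final {P Q : E →L[ℂ] E} (hP : IsStarProjection P)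
    (hQ : IsStarProjection Q) {V : E →L[ℂ] E} (hV : IsPolarIsometry (Q ∘L P) V) :
    hsSq ((1 - Q) ∘L (ContinuousLinearMap.adjoint V ∘L V))
      = hsSq ((1 - P) ∘L (V ∘L ContinuousLinearMap.adjoint V)) := by
  have hVV := hV.isPartialIsometry.comp_adjoint_comp
  have hker : ∀ x, V x = 0 ↔ Q (P x) = 0 := fun x => by
    have := hV.ker_eq
    exact Submodule.ext_iff.1 this x
  have hVP : ∀ x, V (P x) = V x := fun x => by
    have : V (x - P x) = 0 := by rw [hker, map_sub, hP.apply_apply, sub_self, map_zero]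
    rw [map_sub, sub_eq_zero] at this
    exact this.symm
  have hPV : ∀ x, P (ContinuousLinearMap.adjoint V x) = ContinuousLinearMap.adjoint V x := by
    intro x
    refine ext_inner_right ℂ fun y => ?_
    rw [hP.inner_left, ContinuousLinearMap.adjoint_inner_left, hVP,
      ContinuousLinearMap.adjoint_inner_left]
  have hadj : P ∘L Q = modulus (Q ∘L P) ∘L ContinuousLinearMap.adjoint V := by
    have := congrArg ContinuousLinearMap.adjoint hV.eq_comp
    rwa [ContinuousLinearMap.adjoint_comp, ContinuousLinearMap.adjoint_comp, hP.adjoint_eq,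
      hQ.adjoint_eq, modulus_isSelfAdjoint] at this
  -- The range of `V` lies in that of `Q`: `|QP| V* = PQ` kills `(1-Q)Vx`, hence so does `V*`, and
  -- then `(1-Q)Vx` is orthogonal to `Vx`.
  have hQV : ∀ x, Q (V x) = V x := by
    intro x
    have h0 : ContinuousLinearMap.adjoint V (V x - Q (V x)) = 0 := by
      have h1 : modulus (Q ∘L P) (ContinuousLinearMap.adjoint V (V x - Q (V x))) = 0 := by
        have := congrArg (fun T : E →L[ℂ] E => T (V x - Q (V x))) hadj
        simp only [ContinuousLinearMap.comp_apply] at this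
        rw [← this, map_sub, hQ.apply_apply, sub_self, map_zero]
      have h2 : V (ContinuousLinearMap.adjoint V (V x - Q (V x))) = 0 := by
        rw [hker]
        rw [← norm_eq_zero, norm_modulus_apply] at h1
        exact norm_eq_zero.1 h1
      rw [← adjoint_comp_adjoint_of_comp_adjoint_comp hVV, h2, map_zero]
    have h3 : inner ℂ (V x - Q (V x)) (V x - Q (V x)) = 0 := by
      have h4 : inner ℂ (V x - Q (V x)) (Q (V x)) = 0 := by
        rw [← hQ.inner_left, map_sub, hQ.apply_apply, sub_self, inner_zero_left]
      rw [inner_sub_right, h4, sub_zero, ← ContinuousLinearMap.adjoint_inner_left, h0,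
        inner_zero_left]
    exact (sub_eq_zero.1 (inner_self_eq_zero.1 h3)).symm
  have hpt : hsSq ((1 - Q) ∘L (ContinuousLinearMap.adjoint V ∘L V)) = hsSq ((1 - P) ∘L V) := by
    refine hsSq_congr fun x => ?_
    simp only [ContinuousLinearMap.comp_apply, sub_apply, one_apply_eq_self]
    have h1 := hQ.norm_sq_eq (ContinuousLinearMap.adjoint V (V x))
    have h2 := hP.norm_sq_eq (V x)
    have h3 : P (V x) = modulus (Q ∘L P) (ContinuousLinearMap.adjoint V (V x)) := by
      have := congrArg (fun T : E →L[ℂ] E => T (V x)) hadj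
      simp only [ContinuousLinearMap.comp_apply] at this
      rw [← this, hQV]
    rw [h3, norm_modulus_apply, ContinuousLinearMap.comp_apply, hPV,
      ← norm_adjoint_comp_apply hVV, ← h3] at h2
    refine (sq_eq_sq₀ (norm_nonneg _) (norm_nonneg _)).1 ?_
    linarith
  rw [hpt, ← hsSq_adjoint, ← hsSq_adjoint (_ ∘L (_ ∘L _))]
  refine hsSq_congr fun x => ?_
  simp only [ContinuousLinearMap.adjoint_comp, ContinuousLinearMap.adjoint_adjoint,
    hP.one_sub.adjoint_eq, ContinuousLinearMap.comp_apply]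
  have := norm_adjoint_comp_apply (T := ContinuousLinearMap.adjoint V)
    (fun y => by
      rw [ContinuousLinearMap.adjoint_adjoint]
      exact adjoint_comp_adjoint_of_comp_adjoint_comp hVV y) ((1 - P) x)
  rw [ContinuousLinearMap.adjoint_adjoint] at this
  exact this.symm

/-- The index of a pair of projections with Hilbert-Schmidt difference as a difference of traces. -/
theorem hsSq_add_finrank_eq {P Q : E →L[ℂ] E} (hP : IsStarProjection P)
    (hQ : IsStarProjection Q) (h1 : hsSq ((1 - Q) ∘L P) ≠ ∞) (h2 : hsSq ((1 - P) ∘L Q) ≠ ∞) :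
    hsSq ((1 - Q) ∘L P) + Module.finrank ℂ
        (LinearMap.range Q.toLinearMap ⊓ LinearMap.ker P.toLinearMap : Submodule ℂ E)
      = hsSq ((1 - P) ∘L Q) + Module.finrank ℂ
        (LinearMap.ker Q.toLinearMap ⊓ LinearMap.range P.toLinearMap : Submodule ℂ E) := by
  have c1 := completeSpace_inf_ker_range (P := P) (Q := Q) hP
  have c2 := completeSpace_inf_ker_range (P := Q) (Q := P) hQ
  have hV := polarIsometry_spec (Q ∘L P)
  set V := polarIsometry (Q ∘L P)
  have hVV := hV.isPartialIsometry.comp_adjoint_comp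
  have hker : ∀ x, V x = 0 ↔ Q (P x) = 0 := fun x => Submodule.ext_iff.1 hV.ker_eq x
  have hadj : ∀ x, P (Q x) = modulus (Q ∘L P) (ContinuousLinearMap.adjoint V x) := by
    intro x
    have := congrArg ContinuousLinearMap.adjoint hV.eq_comp
    rw [ContinuousLinearMap.adjoint_comp, ContinuousLinearMap.adjoint_comp, hP.adjoint_eq,
      hQ.adjoint_eq, modulus_isSelfAdjoint] at this
    exact congrArg (fun T : E →L[ℂ] E => T x) this
  have e1 := hsSq_compl_comp_eq hP hQ hVV hker
  -- `V*` has the kernel of `PQ`, so it serves the exchanged pair. The nontrivial terms of `e1` and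
  -- `e2` coincide, and only the two dimensions differ.
  have e2 := hsSq_compl_comp_eq (V := ContinuousLinearMap.adjoint V) hQ hP
    (fun x => by
      rw [ContinuousLinearMap.adjoint_adjoint]
      exact adjoint_comp_adjoint_of_comp_adjoint_comp hVV x)
    (fun x => by
      rw [hadj]
      refine ⟨fun h => by rw [h, map_zero], fun h => ?_⟩
      rw [← norm_eq_zero, norm_modulus_apply, norm_eq_zero] at h
      rw [← adjoint_comp_adjoint_of_comp_adjoint_comp hVV, (hker _).2 h, map_zero])
  rw [ContinuousLinearMap.adjoint_adjoint, ← hsSq_compl_comp_initial_eq_final hP hQ hV] at e2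
  have f1 := finiteDimensional_of_hsSq_subtypeL _
    (ne_top_of_le_ne_top h1 (e1 ▸ le_self_add))
  have f2 := finiteDimensional_of_hsSq_subtypeL _
    (ne_top_of_le_ne_top h2 (e2 ▸ le_self_add))
  rw [hsSq_subtypeL] at e1 e2
  rw [e1, e2, inf_comm (LinearMap.range Q.toLinearMap)]
  ring

end Projections

/-! ### Polar decomposition, and finiteness of `‖F - U‖`. -/

section PolarDecomposition

variable {E G : Type*} [NormedAddCommGroup E] [InnerProductSpace ℂ E] [CompleteSpace E]
  [NormedAddCommGroup G] [InnerProductSpace ℂ G] [CompleteSpace G]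

theorem isPartialIsometry_of_comp_adjoint_comp {T : E →L[ℂ] G}
    (h : ∀ x, T (ContinuousLinearMap.adjoint T (T x)) = T x) : IsPartialIsometry T := by
  intro x hx
  have h1 : x - ContinuousLinearMap.adjoint T (T x) ∈ LinearMap.ker T.toLinearMap := by
    change T _ = 0
    rw [map_sub, h, sub_self]
  have h2 : inner ℂ (x - ContinuousLinearMap.adjoint T (T x))
      (x - ContinuousLinearMap.adjoint T (T x)) = 0 := by
    rw [inner_sub_right, (Submodule.mem_orthogonal _ _).1 hx _ h1,
      ContinuousLinearMap.adjoint_inner_right]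
    have : T (x - ContinuousLinearMap.adjoint T (T x)) = 0 := h1
    rw [this, inner_zero_left, sub_zero]
  have h3 := sub_eq_zero.1 (inner_self_eq_zero.1 h2)
  rw [← norm_adjoint_comp_apply h, ← h3]

theorem modulus_modulus_apply (T : E →L[ℂ] G) (x : E) :
    modulus T (modulus T x) = ContinuousLinearMap.adjoint T (T x) :=
  congrArg (fun S : E →L[ℂ] E => S x) (CFC.sqrt_mul_sqrt_self _ (adjoint_comp_nonneg T))

theorem modulus_inner_left (T : E →L[ℂ] G) (x y : E) :
    inner ℂ (modulus T x) y = inner ℂ x (modulus T y) := by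
  conv_lhs => rw [← modulus_isSelfAdjoint T]
  exact ContinuousLinearMap.adjoint_inner_left _ _ _

theorem re_inner_modulus_nonneg (T : E →L[ℂ] G) (x : E) : 0 ≤ (inner ℂ (modulus T x) x).re := by
  have h : (0 : E →L[ℂ] E) ≤ modulus T := CFC.sqrt_nonneg _
  rw [ContinuousLinearMap.nonneg_iff_isPositive] at h
  exact h.re_inner_nonneg_left x

theorem norm_le_norm_add_modulus (T : E →L[ℂ] G) (x : E) : ‖x‖ ≤ ‖x + modulus T x‖ := by
  have h := norm_add_sq (𝕜 := ℂ) x (modulus T x)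
  have h1 := re_inner_modulus_nonneg T x
  rw [modulus_inner_left] at h1
  have h2 : RCLike.re (inner ℂ x (modulus T x)) = (inner ℂ x (modulus T x)).re := rfl
  refine (sq_le_sq₀ (norm_nonneg _) (norm_nonneg _)).1 ?_
  rw [h, h2]
  nlinarith [sq_nonneg ‖modulus T x‖]

variable {F U : E →L[ℂ] G}

theorem IsPolarIsometry.apply_modulus (hU : IsPolarIsometry F U) (x : E) :
    U (modulus F x) = F x :=
  (congrArg (fun S : E →L[ℂ] G => S x) hU.eq_comp).symm

theorem IsPolarIsometry.apply_eq_zero_iff (hU : IsPolarIsometry F U) (x : E) :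
    U x = 0 ↔ F x = 0 :=
  Submodule.ext_iff.1 hU.ker_eq x

theorem IsPolarIsometry.apply_initial (hU : IsPolarIsometry F U) (x : E) :
    F (ContinuousLinearMap.adjoint U (U x)) = F x := by
  have : F (x - ContinuousLinearMap.adjoint U (U x)) = 0 := by
    rw [← hU.apply_eq_zero_iff, map_sub, hU.isPartialIsometry.comp_adjoint_comp, sub_self]
  rw [map_sub, sub_eq_zero] at this
  exact this.symm

theorem IsPolarIsometry.modulus_initial (hU : IsPolarIsometry F U) (x : E) :
    modulus F (ContinuousLinearMap.adjoint U (U x)) = modulus F x := by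
  rw [← sub_eq_zero, ← map_sub, ← norm_eq_zero, norm_modulus_apply, map_sub, hU.apply_initial,
    sub_self, norm_zero]

theorem IsPolarIsometry.initial_modulus (hU : IsPolarIsometry F U) (x : E) :
    ContinuousLinearMap.adjoint U (U (modulus F x)) = modulus F x := by
  refine ext_inner_right ℂ fun y => ?_
  rw [ContinuousLinearMap.adjoint_inner_left, ← ContinuousLinearMap.adjoint_inner_right,
    modulus_inner_left, hU.modulus_initial, modulus_inner_left]

theorem IsPolarIsometry.norm_sub_apply (hU : IsPolarIsometry F U) (x : E) :
    ‖(F - U) x‖ = ‖modulus F x - ContinuousLinearMap.adjoint U (U x)‖ := by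
  have h1 : (F - U) x = U (modulus F x - ContinuousLinearMap.adjoint U (U x)) := by
    rw [map_sub, hU.isPartialIsometry.comp_adjoint_comp, hU.apply_modulus, sub_apply]
  rw [h1, ← norm_adjoint_comp_apply hU.isPartialIsometry.comp_adjoint_comp, map_sub, map_sub,
    hU.initial_modulus, hU.isPartialIsometry.comp_adjoint_comp]

theorem IsPolarIsometry.initial_mem (hU : IsPolarIsometry F U) (x : G) :
    ContinuousLinearMap.adjoint U x ∈ (LinearMap.ker F.toLinearMap)ᗮ := by
  rw [← hU.ker_eq, Submodule.mem_orthogonal]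
  intro y hy
  have : U y = 0 := hy
  rw [ContinuousLinearMap.adjoint_inner_right, this, inner_zero_left]

/-- Since `Q = X*X` is idempotent and `D² - Q` is Hilbert-Schmidt for `D = |F|`, so is `D² - D⁴`.
This operator is `-(D² + D³)(D - P)`, and `D² + D³` is bounded below on `ran P` by `c²`, so `D - P`
is Hilbert-Schmidt, and it has pointwise the norm of `F - U`. -/
theorem hsSq_sub_initial_ne_top (hU : IsPolarIsometry F U) {c : ℝ} (hc : 0 < c)
    (hF : ∀ x ∈ (LinearMap.ker F.toLinearMap)ᗮ, c * ‖x‖ ≤ ‖F x‖) {X : E →L[ℂ] G}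
    (hX : IsPartialIsometry X) (hXF : hsSq (X - F) ≠ ∞) : hsSq (F - U) ≠ ∞ := by
  set D := modulus F with hD
  set P := ContinuousLinearMap.adjoint U ∘L U with hP
  set Q := ContinuousLinearMap.adjoint X ∘L X with hQ
  have hQs := hX.isStarProjection
  have hA : hsSq (D ∘L D - Q) ≠ ∞ := by
    have : D ∘L D - Q = -(ContinuousLinearMap.adjoint F ∘L (X - F)
        + ContinuousLinearMap.adjoint (X - F) ∘L X) := by
      ext x
      have : D (D x) = ContinuousLinearMap.adjoint F (F x) := modulus_modulus_apply F x
      simp [this, hQ]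
    rw [this, hsSq_neg]
    refine hsSq_add_ne_top (hsSq_comp_left_ne_top _ hXF) (hsSq_comp_right_ne_top _ ?_)
    rwa [hsSq_adjoint]
  have hB : hsSq (D ∘L D - (D ∘L D) ∘L (D ∘L D)) ≠ ∞ := by
    have : D ∘L D - (D ∘L D) ∘L (D ∘L D)
        = (D ∘L D - Q) - ((D ∘L D) ∘L (D ∘L D - Q) + (D ∘L D - Q) ∘L Q) := by
      ext x
      have : Q (Q x) = Q x := hQs.apply_apply x
      simp [this]
    rw [this]
    exact hsSq_sub_ne_top hA
      (hsSq_add_ne_top (hsSq_comp_left_ne_top _ hA) (hsSq_comp_right_ne_top _ hA))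
  refine hsSq_ne_top_of_norm_le (C := (c ^ 2)⁻¹) (by positivity) (fun x => ?_) hB
  set y := D x - P x with hy
  have hPy : P y = y := by
    have h1 : P (D x) = D x := hU.initial_modulus x
    have h2 : P (P x) = P x := hU.isPartialIsometry.isStarProjection.apply_apply x
    rw [hy, map_sub, h1, h2]
  have hDP : ∀ z, D (P z) = D z := hU.modulus_initial
  have hUy : ‖(F - U) x‖ = ‖y‖ := hU.norm_sub_apply x
  have hlow : ∀ z, P z = z → c * ‖z‖ ≤ ‖D z‖ := fun z hz => by
    rw [hD, norm_modulus_apply]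
    refine hF z ?_
    rw [← hz]
    exact hU.initial_mem _
  have h1 : (D ∘L D - (D ∘L D) ∘L (D ∘L D)) x = -(D (D y) + D (D (D y))) := by
    simp [hy, hDP]
  have hPD : ∀ z, P (D z) = D z := hU.initial_modulus
  have h2 : ‖D (D y)‖ ≤ ‖D (D y) + D (D (D y))‖ := norm_le_norm_add_modulus F _
  have h3 := hlow (D y) (hPD y)
  have h4 := hlow y hPy
  rw [hUy, h1, norm_neg, inv_mul_eq_div, le_div_iff₀ (by positivity)]
  nlinarith

end PolarDecomposition

/-! ### Dictionary between frames and synthesis operators. -/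

section Synthesis

/-- The standard basis of `ℓ²` as a Hilbert basis. -/
noncomputable def stdBasis : HilbertBasis ℕ ℂ Seq2 :=
  HilbertBasis.ofRepr (LinearIsometryEquiv.refl ℂ Seq2)

theorem stdBasis_apply (i : ℕ) : stdBasis i = e i := by
  rw [← HilbertBasis.repr_symm_single]
  rfl

variable {H : Type*} [NormedAddCommGroup H] [InnerProductSpace ℂ H]

theorem ext_e {S T : Seq2 →L[ℂ] H} (h : ∀ i, S (e i) = T (e i)) : S = T := by
  refine ContinuousLinearMap.ext_on (s := Set.range stdBasis) ?_ ?_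
  · have := stdBasis.dense_span
    rwa [Submodule.dense_iff_topologicalClosure_eq_top]
  · rintro _ ⟨i, rfl⟩
    rw [stdBasis_apply, h]

variable [CompleteSpace H]

theorem synthesis_apply_e (T : Seq2 →L[ℂ] H) : synthesis (fun i => T (e i)) = T := by
  have h : ∃ S : Seq2 →L[ℂ] H, ∀ i, S (e i) = T (e i) := ⟨T, fun _ => rfl⟩
  rw [synthesis, dif_pos h]
  exact ext_e h.choose_spec

theorem sqDist_eq_hsSq (S T : Seq2 →L[ℂ] H) :
    sqDist (fun i => S (e i)) (fun i => T (e i)) = hsSq (S - T) := by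
  rw [hsSq_eq stdBasis]
  simp only [stdBasis_apply, sqDist, sub_apply]

theorem hasSum_norm_inner_synthesis_sq (T : Seq2 →L[ℂ] H) (g : H) :
    HasSum (fun i => ‖inner ℂ (T (e i)) g‖ ^ 2) (‖ContinuousLinearMap.adjoint T g‖ ^ 2) := by
  refine (hasSum_norm_inner_sq stdBasis (ContinuousLinearMap.adjoint T g)).congr_fun fun i => ?_
  rw [stdBasis_apply, ContinuousLinearMap.adjoint_inner_right]

theorem IsFrameIn.synthesis_mem {K : Submodule ℂ H} {f : ℕ → H} (h : IsFrameIn K f) (x : Seq2) :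
    synthesis f x ∈ K := by
  have : CompleteSpace K := h.isClosed.completeSpace_coe
  have h1 : K.starProjection ∘L synthesis f = synthesis f := ext_e fun i => by
    rw [ContinuousLinearMap.comp_apply, h.synthesis_apply]
    exact Submodule.starProjection_eq_self_iff.2 (h.mem i)
  rw [← h1]
  exact Submodule.starProjection_apply_mem K _

/-- The lower frame bound says that `F*` is bounded below by `√A` on `K ⊇ ran F`. It transfers to
`F` on `ran |F|`, which is dense in `(ker F)ᗮ`, because `‖F |F| z‖ = ‖F*F z‖` and `‖|F| z‖ = ‖F z‖`.
-/
theorem IsFrameIn.exists_lower_bound {K : Submodule ℂ H} {f : ℕ → H} (h : IsFrameIn K f) :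
    ∃ c : ℝ, 0 < c ∧ ∀ x ∈ (LinearMap.ker (synthesis f).toLinearMap)ᗮ,
      c * ‖x‖ ≤ ‖synthesis f x‖ := by
  obtain ⟨A, B, hA, -, hb⟩ := h.bounds
  set F := synthesis f with hF
  refine ⟨Real.sqrt A, Real.sqrt_pos.2 hA, fun x hx => ?_⟩
  have h1 : ∀ g ∈ K, Real.sqrt A * ‖g‖ ≤ ‖ContinuousLinearMap.adjoint F g‖ := by
    intro g hg
    have h2 := (hb g hg).2.1
    have h3 := (hasSum_norm_inner_synthesis_sq F g).tsum_eq
    simp only [hF, h.synthesis_apply] at h3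
    rw [h3] at h2
    refine (sq_le_sq₀ (by positivity) (norm_nonneg _)).1 ?_
    rwa [mul_pow, Real.sq_sqrt hA.le]
  have hcl : IsClosed {z | Real.sqrt A * ‖z‖ ≤ ‖F z‖} :=
    isClosed_le (by fun_prop) (by fun_prop)
  rw [← range_modulus_orthogonal, Submodule.orthogonal_orthogonal_eq_closure] at hx
  refine closure_minimal ?_ hcl hx
  rintro _ ⟨z, rfl⟩
  change Real.sqrt A * ‖modulus F z‖ ≤ ‖F (modulus F z)‖
  rw [norm_modulus_apply, ← norm_modulus_apply F (modulus F z), modulus_modulus_apply]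
  exact h1 _ (h.synthesis_mem z)

/-- The Parseval identity makes `X*` isometric on `L`; since `ran X ⊆ L`, polarisation gives `XX* =
1` on `L`, hence `XX*X = X`. -/
theorem IsParsevalFrameIn.isPartialIsometry {L : Submodule ℂ H} {x : ℕ → H}
    (h : IsParsevalFrameIn L x) : IsPartialIsometry (synthesis x) := by
  set X := synthesis x with hX
  have hn : ∀ g ∈ L, ‖ContinuousLinearMap.adjoint X g‖ = ‖g‖ := fun g hg => by
    have h1 := hasSum_norm_inner_synthesis_sq X g
    simp only [hX, h.isFrameIn.synthesis_apply] at h1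
    exact (sq_eq_sq₀ (norm_nonneg _) (norm_nonneg _)).1 (h1.unique (h.hasSum g hg))
  let J : L →ₗᵢ[ℂ] Seq2 :=
    ⟨(ContinuousLinearMap.adjoint X).toLinearMap ∘ₗ L.subtype, fun g => hn g g.2⟩
  have hmem : ∀ z, X z ∈ L := h.isFrameIn.synthesis_mem
  refine isPartialIsometry_of_comp_adjoint_comp fun z => ?_
  have key : ∀ g k : L, inner ℂ (X (ContinuousLinearMap.adjoint X g)) (k : H)
      = inner ℂ (g : H) (k : H) := fun g k => by
    rw [← ContinuousLinearMap.adjoint_inner_right]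
    exact J.inner_map_map g k
  set w := X (ContinuousLinearMap.adjoint X (X z)) - X z with hw
  have hwL : w ∈ L := L.sub_mem (hmem _) (hmem _)
  have := key ⟨X z, hmem z⟩ ⟨w, hwL⟩
  rw [← sub_eq_zero, ← inner_sub_left] at this
  exact sub_eq_zero.1 (inner_self_eq_zero.1 this)

theorem IsPartialIsometry.exists_isParsevalFrameIn {T : Seq2 →L[ℂ] H} (h : IsPartialIsometry T) :
    ∃ L : Submodule ℂ H, IsParsevalFrameIn L (fun i => T (e i)) := by
  refine ⟨LinearMap.range T.toLinearMap, ?_, fun i => ⟨e i, rfl⟩, ?_⟩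
  · have : (LinearMap.range T.toLinearMap : Set H)
        = {y | T (ContinuousLinearMap.adjoint T y) = y} := by
      ext y
      constructor
      · rintro ⟨x, rfl⟩
        exact h.comp_adjoint_comp x
      · exact fun hy => ⟨_, hy⟩
    rw [this]
    exact isClosed_eq (by fun_prop) continuous_id
  · rintro _ ⟨x, rfl⟩
    have := hasSum_norm_inner_synthesis_sq T (T x)
    rwa [norm_adjoint_comp_apply h.comp_adjoint_comp] at this

end Synthesis

/-! ### The distance formula `‖F - X‖² = ‖F - U‖² + n + R`. -/

section DistanceFormula

variable {E G : Type*} [NormedAddCommGroup E] [InnerProductSpace ℂ E] [CompleteSpace E]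
  [NormedAddCommGroup G] [InnerProductSpace ℂ G] [CompleteSpace G]

theorem hsSq_eq_comp_add_comp_compl (T : E →L[ℂ] G) {P : E →L[ℂ] E} (hP : IsStarProjection P) :
    hsSq T = hsSq (T ∘L P) + hsSq (T ∘L (1 - P)) := by
  rw [← hsSq_adjoint T, ← hsSq_adjoint (_ ∘L _), ← hsSq_adjoint (_ ∘L (1 - P))]
  refine hsSq_eq_add fun x => ?_
  simp only [ContinuousLinearMap.adjoint_comp, hP.adjoint_eq, hP.one_sub.adjoint_eq,
    ContinuousLinearMap.comp_apply, sub_apply, one_apply_eq_self]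
  exact hP.norm_sq_eq _

variable {F U X : E →L[ℂ] G}

theorem IsPartialIsometry.norm_adjoint_comp (hX : IsPartialIsometry X) (x : E) :
    ‖ContinuousLinearMap.adjoint X (X x)‖ = ‖X x‖ :=
  norm_adjoint_comp_apply hX.comp_adjoint_comp x

theorem IsPartialIsometry.norm_sq_eq (hX : IsPartialIsometry X) (x : E) :
    ‖x‖ ^ 2 = ‖X x‖ ^ 2 + ‖x - ContinuousLinearMap.adjoint X (X x)‖ ^ 2 := by
  have := hX.isStarProjection.norm_sq_eq x
  rwa [ContinuousLinearMap.comp_apply, hX.norm_adjoint_comp] at this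

/-- Here `F w = s • U w`. The term `‖w - X*X w‖²` completes `‖X w‖²` to `‖w‖²`, so the left side is
`(s² + 1)‖w‖² - 2s Re⟨Uw, Xw⟩`, against `(s - 1)²‖w‖²` for `U`. -/
theorem norm_sq_add_norm_sq_of_modulus_eq (hU : IsPolarIsometry F U) (hX : IsPartialIsometry X)
    {w : E} (hw : ContinuousLinearMap.adjoint U (U w) = w) {s : ℝ}
    (hs : modulus F w = (s : ℂ) • w) :
    ‖(F - X) w‖ ^ 2 + ‖w - ContinuousLinearMap.adjoint X (X w)‖ ^ 2
      = ‖(F - U) w‖ ^ 2 + 2 * s * (‖w‖ ^ 2 - (inner ℂ (U w) (X w)).re) := by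
  have hFw : F w = (s : ℂ) • U w := by rw [← hU.apply_modulus, hs, map_smul]
  have hUw : ‖U w‖ = ‖w‖ := by rw [← hU.isPartialIsometry.norm_adjoint_comp, hw]
  have h1 := hX.norm_sq_eq w
  have h2 : (F - U) w = ((s - 1 : ℝ) : ℂ) • U w := by
    rw [sub_apply, hFw]
    push_cast
    rw [sub_smul, one_smul]
  have h3 := norm_sub_sq (𝕜 := ℂ) (F w) (X w)
  have h4 : RCLike.re (inner ℂ (F w) (X w)) = s * (inner ℂ (U w) (X w)).re := by
    rw [hFw, inner_smul_left]
    simp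
  have h5 : ‖F w‖ ^ 2 = s ^ 2 * ‖w‖ ^ 2 := by
    rw [hFw, norm_smul, hUw, mul_pow]
    simp
  have h6 : ‖(F - U) w‖ ^ 2 = (s - 1) ^ 2 * ‖w‖ ^ 2 := by
    rw [h2, norm_smul, hUw, mul_pow, Complex.norm_real, Real.norm_eq_abs, sq_abs]
  rw [h4, h5] at h3
  rw [sub_apply, h3, h6]
  linarith

/-- Applying `P` gives the eigenvalue `μ + 1` of `|F|`. It is real and nonnegative because `|F|` is
positive, and nonzero because `|F|` is injective on `ran P`. -/
theorem exists_modulus_eigenvalue (hU : IsPolarIsometry F U) {v : E} {μ : ℂ}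
    (hv : modulus F v - ContinuousLinearMap.adjoint U (U v) = μ • v) :
    ∃ s : ℝ, 0 < s ∧ modulus F (ContinuousLinearMap.adjoint U (U v))
      = (s : ℂ) • ContinuousLinearMap.adjoint U (U v) := by
  set w := ContinuousLinearMap.adjoint U (U v) with hw
  have hPw : ContinuousLinearMap.adjoint U (U w) = w := by
    rw [hw, hU.isPartialIsometry.comp_adjoint_comp]
  have h1 : modulus F w = (μ + 1) • w := by
    have := congrArg (fun x => ContinuousLinearMap.adjoint U (U x)) hv
    simp only [map_sub, map_smul, hU.initial_modulus, hPw, ← hw] at this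
    rw [hw, hU.modulus_initial, ← hw, add_smul, one_smul, ← this, sub_add_cancel]
  by_cases h0 : w = 0
  -- If the component in `ran P` is zero, any positive value serves.
  · exact ⟨1, one_pos, by rw [h0]; simp⟩
  have hn : 0 < ‖w‖ ^ 2 := by positivity
  have h2 := modulus_inner_left F w w
  have h3 := re_inner_modulus_nonneg F w
  rw [h1, inner_smul_left, inner_smul_right] at h2
  rw [h1, inner_smul_left] at h3
  have hi : inner ℂ w w = ((‖w‖ ^ 2 : ℝ) : ℂ) := by
    rw [inner_self_eq_norm_sq_to_K]
    simp
  have hc : (starRingEnd ℂ) (μ + 1) = μ + 1 :=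
    mul_right_cancel₀ (by rw [Ne, inner_self_eq_zero]; exact h0) h2
  obtain ⟨s, hs⟩ := Complex.conj_eq_iff_real.1 hc
  rw [hc, hs, hi, ← Complex.ofReal_mul, Complex.ofReal_re] at h3
  rw [hs] at h1
  refine ⟨s, lt_of_le_of_ne (nonneg_of_mul_nonneg_left h3 hn) fun h => h0 ?_, h1⟩
  rw [← h, Complex.ofReal_zero, zero_smul, ← norm_eq_zero, norm_modulus_apply, norm_eq_zero,
    ← hU.apply_eq_zero_iff] at h1
  rw [← hPw, h1, map_zero]

/-- Comparison of the distances of `F` to a partial isometry `X` and to its polar isometry `U`. -/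
theorem exists_hsSq_sub_add_eq (hU : IsPolarIsometry F U) (hFU : hsSq (F - U) ≠ ∞)
    (hX : IsPartialIsometry X) :
    ∃ R : ℝ≥0∞, (R = 0 ↔ ∀ x, X (ContinuousLinearMap.adjoint U (U x)) = U x) ∧
      hsSq (F - X) + hsSq ((1 - ContinuousLinearMap.adjoint X ∘L X)
          ∘L (ContinuousLinearMap.adjoint U ∘L U))
        = hsSq (F - U) + hsSq ((1 - ContinuousLinearMap.adjoint U ∘L U)
          ∘L (ContinuousLinearMap.adjoint X ∘L X)) + R := by
  set P := ContinuousLinearMap.adjoint U ∘L U with hP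
  set Q := ContinuousLinearMap.adjoint X ∘L X with hQ
  have hPs : IsStarProjection P := hU.isPartialIsometry.isStarProjection
  have hQs : IsStarProjection Q := hX.isStarProjection
  have hUP : ∀ x, U (P x) = U x := hU.isPartialIsometry.comp_adjoint_comp
  have hFP : ∀ x, F (P x) = F x := hU.apply_initial
  have hT : hsSq (modulus F - P) ≠ ∞ := by
    rwa [← hsSq_congr fun x => hU.norm_sub_apply x]
  have hsym : (modulus F - P).toLinearMap.IsSymmetric := fun x y => by
    simp only [ContinuousLinearMap.coe_coe, sub_apply, inner_sub_left, inner_sub_right,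
      modulus_inner_left, hPs.inner_left]
  obtain ⟨ι, b, hb⟩ := exists_hilbertBasis_eigenvectors (isCompactOperator_of_hsSq_ne_top hT) hsym
  choose μ hμ using hb
  choose s hs0 hs using fun i => exists_modulus_eigenvalue hU (hμ i)
  have hre : ∀ w, P w = w → ‖(U - X) w‖ ^ 2 ≤ 2 * (‖w‖ ^ 2 - (inner ℂ (U w) (X w)).re) := by
    intro w hw
    have h1 := hX.norm_sq_eq w
    have h2 : ‖U w‖ = ‖w‖ := by
      rw [← hU.isPartialIsometry.norm_adjoint_comp]
      exact congrArg norm hw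
    have h3 := norm_sub_sq (𝕜 := ℂ) (U w) (X w)
    have h4 : RCLike.re (inner ℂ (U w) (X w)) = (inner ℂ (U w) (X w)).re := rfl
    rw [sub_apply, h3, h2, h4]
    nlinarith [sq_nonneg ‖w - ContinuousLinearMap.adjoint X (X w)‖]
  -- By `hre`, `r i ≥ s i * ‖(U - X) P (b i)‖²`. As `s i > 0`, the vanishing of all `r i` forces `X`
  -- and `U` to agree on every `P (b i)`.
  let r : ι → ℝ := fun i => 2 * s i * (‖P (b i)‖ ^ 2 - (inner ℂ (U (P (b i))) (X (P (b i)))).re)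
  have hr0 : ∀ i, 0 ≤ r i := fun i => by
    have := hre (P (b i)) (hPs.apply_apply _)
    have h1 := sq_nonneg ‖(U - X) (P (b i))‖
    have := hs0 i
    have : 0 ≤ ‖P (b i)‖ ^ 2 - (inner ℂ (U (P (b i))) (X (P (b i)))).re := by linarith
    simp only [r]
    positivity
  refine ⟨∑' i, ENNReal.ofReal (r i), ?_, ?_⟩
  · rw [ENNReal.tsum_eq_zero]
    constructor
    · intro h
      have : X ∘L P = U := by
        refine ContinuousLinearMap.ext_on (s := Set.range b) ?_ ?_
        · have := b.dense_span
          rwa [Submodule.dense_iff_topologicalClosure_eq_top]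
        · rintro _ ⟨i, rfl⟩
          have h1 := le_antisymm (ENNReal.ofReal_eq_zero.1 (h i)) (hr0 i)
          have h2 : ‖P (b i)‖ ^ 2 - (inner ℂ (U (P (b i))) (X (P (b i)))).re = 0 := by
            have := hs0 i
            rcases mul_eq_zero.1 h1 with h3 | h3
            · linarith
            · exact h3
          have h3 := hre (P (b i)) (hPs.apply_apply _)
          rw [h2, mul_zero] at h3
          have h4 := pow_eq_zero_iff (two_ne_zero) |>.1 (le_antisymm h3 (sq_nonneg _))
          rw [norm_eq_zero, sub_apply, hUP, sub_eq_zero] at h4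
          exact h4.symm
      exact fun x => congrArg (fun T : E →L[ℂ] G => T x) this
    · intro h i
      have h1 : X (P (b i)) = U (P (b i)) := by rw [hUP]; exact h _
      have h2 : ‖U (P (b i))‖ = ‖P (b i)‖ := by
        rw [← hU.isPartialIsometry.norm_adjoint_comp]
        exact congrArg norm (hPs.apply_apply (b i))
      have h3 : (inner ℂ (U (P (b i))) (U (P (b i)))).re = ‖U (P (b i))‖ ^ 2 :=
        inner_self_eq_norm_sq (𝕜 := ℂ) _
      simp only [r, h1, h3, h2, sub_self, mul_zero, ENNReal.ofReal_zero]
  -- `F` vanishes on `ran (1 - P)`, and `X(1-P)` has pointwise the norm of `Q(1-P)`, the adjoint of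
  -- `(1-P)Q`.
  · have e1 : hsSq ((F - X) ∘L (1 - P)) = hsSq ((1 - P) ∘L Q) := by
      rw [← hsSq_adjoint (_ ∘L Q), ContinuousLinearMap.adjoint_comp, hQs.adjoint_eq,
        hPs.one_sub.adjoint_eq]
      refine hsSq_congr fun x => ?_
      have : F ((1 - P) x) = 0 := by
        rw [sub_apply, one_apply_eq_self, map_sub, hFP, sub_self]
      rw [ContinuousLinearMap.comp_apply, sub_apply, this, zero_sub, norm_neg]
      exact (hX.norm_adjoint_comp _).symm
    rw [hsSq_eq_comp_add_comp_compl (F - X) hPs, e1]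
    have e2 : hsSq ((F - X) ∘L P) + hsSq ((1 - Q) ∘L P)
        = hsSq (F - U) + ∑' i, ENNReal.ofReal (r i) := by
      simp only [hsSq_eq b, ← ENNReal.tsum_add]
      congr! 2 with i
      simp only [enorm_sq_eq_ofReal]
      rw [← ENNReal.ofReal_add (by positivity) (by positivity),
        ← ENNReal.ofReal_add (by positivity) (hr0 i)]
      congr 1
      have h1 := norm_sq_add_norm_sq_of_modulus_eq hU hX (hPs.apply_apply (b i)) (hs i)
      have h2 : (F - U) (b i) = (F - U) (P (b i)) := by
        rw [sub_apply, sub_apply, hFP, hUP]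
      rw [h2]
      exact h1
    rw [add_right_comm, e2]
    ring

theorem exists_hsSq_sub_eq (hU : IsPolarIsometry F U) (hFU : hsSq (F - U) ≠ ∞)
    (hX : IsPartialIsometry X) (hFX : hsSq (F - X) ≠ ∞) {n : ℕ}
    (hn : pairIndex (ContinuousLinearMap.adjoint U ∘L U) (ContinuousLinearMap.adjoint X ∘L X)
      = -n) :
    ∃ R : ℝ≥0∞, (R = 0 ↔ ∀ x, X (ContinuousLinearMap.adjoint U (U x)) = U x) ∧
      hsSq (F - X) = hsSq (F - U) + n + R := by
  obtain ⟨R, hR, h⟩ := exists_hsSq_sub_add_eq hU hFU hX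
  refine ⟨R, hR, ?_⟩
  set P := ContinuousLinearMap.adjoint U ∘L U with hP
  set Q := ContinuousLinearMap.adjoint X ∘L X with hQ
  have hPs : IsStarProjection P := hU.isPartialIsometry.isStarProjection
  have hQs : IsStarProjection Q := hX.isStarProjection
  have hUX : hsSq (U - X) ≠ ∞ := by
    have : U - X = (F - X) - (F - U) := by abel
    rw [this]
    exact hsSq_sub_ne_top hFX hFU
  have hPQ : hsSq (P - Q) ≠ ∞ := by
    have : P - Q = ContinuousLinearMap.adjoint U ∘L (U - X)
        + ContinuousLinearMap.adjoint (U - X) ∘L X := by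
      ext x
      simp [hP, hQ]
    rw [this]
    exact hsSq_add_ne_top (hsSq_comp_left_ne_top _ hUX)
      (hsSq_comp_right_ne_top _ (by rwa [hsSq_adjoint]))
  have h1 : hsSq ((1 - Q) ∘L P) ≠ ∞ := by
    have : (1 - Q) ∘L P = (P - Q) ∘L P := by
      ext x
      simp [hPs.apply_apply]
    rw [this]
    exact hsSq_comp_right_ne_top _ hPQ
  have h2 : hsSq ((1 - P) ∘L Q) ≠ ∞ := by
    have : (1 - P) ∘L Q = -((P - Q) ∘L Q) := by
      ext x
      simp [hQs.apply_apply]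
    rw [this, hsSq_neg]
    exact hsSq_comp_right_ne_top _ hPQ
  have h3 := hsSq_add_finrank_eq hPs hQs h1 h2
  rw [pairIndex] at hn
  set N0 := Module.finrank ℂ
    (LinearMap.ker Q.toLinearMap ⊓ LinearMap.range P.toLinearMap : Submodule ℂ E)
  set N1 := Module.finrank ℂ
    (LinearMap.range Q.toLinearMap ⊓ LinearMap.ker P.toLinearMap : Submodule ℂ E)
  have h4 : N1 = N0 + n := by omega
  have h5 : hsSq ((1 - Q) ∘L P) + n = hsSq ((1 - P) ∘L Q) := by
    rw [h4, Nat.cast_add] at h3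
    refine (ENNReal.add_left_inj (ENNReal.natCast_ne_top N0)).1 ?_
    rw [← h3]
    ring
  rw [← h5] at h
  -- The common term `‖(1-Q)P‖²` may be cancelled because `P - Q` is Hilbert-Schmidt.
  refine (ENNReal.add_left_inj h1).1 ?_
  rw [h]
  ring

end DistanceFormula

/-! ### Partial isometries that extend `U`. -/

section Extensions

variable {E G : Type*} [NormedAddCommGroup E] [InnerProductSpace ℂ E] [CompleteSpace E]
  [NormedAddCommGroup G] [InnerProductSpace ℂ G] [CompleteSpace G]

/-- For `P ≤ Q` the operator in question is the inclusion of `ran P` in `ran Q`. Restricting `P` to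
`ran Q` inverts it exactly on the left, and on the right up to the finite-rank projection onto `ran
Q ∩ ker P`. -/
theorem isFredholmPair_of_comp_eq {P Q : E →L[ℂ] E} (hP : IsStarProjection P)
    (hQ : IsStarProjection Q) (hQP : ∀ x, Q (P x) = P x) (hPQ : ∀ x, P (Q x) = P x)
    [FiniteDimensional ℂ
      (LinearMap.range Q.toLinearMap ⊓ LinearMap.ker P.toLinearMap : Submodule ℂ E)] :
    IsFredholmPair P Q := by
  set N : Submodule ℂ E := LinearMap.range Q.toLinearMap ⊓ LinearMap.ker P.toLinearMap with hN
  refine ContinuousLinearMap.IsFredholm.of_isQuasiInverse (v := pairOperator Q P) ⟨?_, ?_⟩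
  · have : (pairOperator Q P).toLinearMap ∘ₗ (pairOperator P Q).toLinearMap = LinearMap.id := by
      ext ⟨x, hx⟩
      have hx' : P x = x := hP.mem_range_iff.1 hx
      change P (Q (Q (P x))) = x
      rw [hQ.apply_apply, hPQ, hx', hx']
    rw [LinearMap.IsLeftQuasiInverse, this]
  · have hmem : ∀ y : LinearMap.range Q.toLinearMap, (y : E) - P y ∈ N := fun y =>
      ⟨hQ.mem_range_iff.2 (by rw [map_sub, hQP, hQ.mem_range_iff.1 y.2]), by
        change P _ = 0
        rw [map_sub, hP.apply_apply, sub_self]⟩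
    let g : LinearMap.range Q.toLinearMap →ₗ[ℂ] N :=
      ((LinearMap.id - P.toLinearMap) ∘ₗ (LinearMap.range Q.toLinearMap).subtype).codRestrict N
        hmem
    have : (pairOperator P Q).toLinearMap ∘ₗ (pairOperator Q P).toLinearMap - LinearMap.id
        = -(Submodule.inclusion (inf_le_left : N ≤ LinearMap.range Q.toLinearMap) ∘ₗ g) := by
      ext ⟨y, hy⟩
      have hy' : Q y = y := hQ.mem_range_iff.1 hy
      change Q (P (P (Q y))) - y = -(y - P y)
      rw [hP.apply_apply, hQP, hPQ]
      abel
    rw [LinearMap.IsRightQuasiInverse, LinearMap.FiniteRangeSetoid.equiv_iff_hasFiniteRange, this]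
    have h1 : (Submodule.inclusion
        (inf_le_left : N ≤ LinearMap.range Q.toLinearMap)).HasFiniteRange :=
      LinearMap.HasFiniteRange.of_finite_dom
    exact (h1.comp_right g).neg

variable {F U X : E →L[ℂ] G}

theorem IsPartialIsometry.initial_eq_self_iff (hX : IsPartialIsometry X) {x : E} :
    ContinuousLinearMap.adjoint X (X x) = x ↔ ‖X x‖ = ‖x‖ := by
  constructor
  · intro h
    rw [← hX.norm_adjoint_comp, h]
  · intro h
    have h1 := hX.norm_sq_eq x
    rw [h, left_eq_add] at h1
    have h2 := pow_eq_zero_iff (two_ne_zero) |>.1 h1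
    exact (sub_eq_zero.1 (norm_eq_zero.1 h2)).symm

theorem initial_initial_eq (hU : IsPolarIsometry F U) (hX : IsPartialIsometry X)
    (h : ∀ x, X (ContinuousLinearMap.adjoint U (U x)) = U x) (x : E) :
    ContinuousLinearMap.adjoint X (X (ContinuousLinearMap.adjoint U (U x)))
      = ContinuousLinearMap.adjoint U (U x) := by
  rw [hX.initial_eq_self_iff, h, hU.isPartialIsometry.norm_adjoint_comp]

theorem initial_initial_eq' (hU : IsPolarIsometry F U) (hX : IsPartialIsometry X)
    (h : ∀ x, X (ContinuousLinearMap.adjoint U (U x)) = U x) (x : E) :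
    ContinuousLinearMap.adjoint U (U (ContinuousLinearMap.adjoint X (X x)))
      = ContinuousLinearMap.adjoint U (U x) := by
  have hP := hU.isPartialIsometry.isStarProjection
  have hQ := hX.isStarProjection
  refine ext_inner_right ℂ fun y => ?_
  have h1 := hP.inner_left (ContinuousLinearMap.adjoint X (X x)) y
  have h2 := hQ.inner_left x (ContinuousLinearMap.adjoint U (U y))
  have h3 := hP.inner_left x y
  simp only [ContinuousLinearMap.comp_apply] at h1 h2 h3
  rw [h1, h2, initial_initial_eq hU hX h, h3]

theorem initial_eq_zero_iff (hU : IsPolarIsometry F U) (x : E) :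
    ContinuousLinearMap.adjoint U (U x) = 0 ↔ F x = 0 := by
  rw [← norm_eq_zero, hU.isPartialIsometry.norm_adjoint_comp, norm_eq_zero,
    hU.apply_eq_zero_iff]

theorem injective_domRestrict_range_initial (hX : IsPartialIsometry X) {N : Submodule ℂ E}
    (hN : N ≤ LinearMap.range (ContinuousLinearMap.adjoint X ∘L X).toLinearMap) :
    Function.Injective (X.toLinearMap.domRestrict N) := by
  rw [← LinearMap.ker_eq_bot, LinearMap.ker_eq_bot']
  rintro ⟨x, hx⟩ h
  have h1 : X x = 0 := h
  have h2 := hX.isStarProjection.mem_range_iff.1 (hN hx)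
  rw [ContinuousLinearMap.comp_apply, h1, map_zero] at h2
  exact Subtype.ext h2.symm

theorem range_domRestrict_inf_eq (hU : IsPolarIsometry F U) (hX : IsPartialIsometry X)
    (h : ∀ x, X (ContinuousLinearMap.adjoint U (U x)) = U x) :
    LinearMap.range (X.toLinearMap.domRestrict
      (LinearMap.range (ContinuousLinearMap.adjoint X ∘L X).toLinearMap ⊓
        LinearMap.ker (ContinuousLinearMap.adjoint U ∘L U).toLinearMap))
      = (LinearMap.ker F.toLinearMap).map X.toLinearMap := by
  ext y
  constructor
  · rintro ⟨⟨x, hx⟩, rfl⟩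
    exact ⟨x, (initial_eq_zero_iff hU x).1 hx.2, rfl⟩
  · rintro ⟨x, hx, rfl⟩
    refine ⟨⟨ContinuousLinearMap.adjoint X (X x), ⟨x, rfl⟩, ?_⟩, hX.comp_adjoint_comp x⟩
    change ContinuousLinearMap.adjoint U (U _) = 0
    rw [initial_initial_eq' hU hX h]
    exact (initial_eq_zero_iff hU x).2 hx

/-- Agreement with `U` gives `P ≤ Q`, so `ker Q ∩ ran P = 0`, while `X` maps `ran Q ∩ ker P`
bijectively onto `X(ker F)`. -/
theorem pairIndex_eq_neg_finrank (hU : IsPolarIsometry F U) (hX : IsPartialIsometry X)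
    (h : ∀ x, X (ContinuousLinearMap.adjoint U (U x)) = U x) :
    pairIndex (ContinuousLinearMap.adjoint U ∘L U) (ContinuousLinearMap.adjoint X ∘L X)
      = -(Module.finrank ℂ ((LinearMap.ker F.toLinearMap).map X.toLinearMap) : ℤ) := by
  have h0 : (LinearMap.ker (ContinuousLinearMap.adjoint X ∘L X).toLinearMap ⊓
      LinearMap.range (ContinuousLinearMap.adjoint U ∘L U).toLinearMap : Submodule ℂ E) = ⊥ := by
    rw [Submodule.eq_bot_iff]
    rintro x ⟨h1, h2⟩
    have h3 : ContinuousLinearMap.adjoint U (U x) = x :=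
      hU.isPartialIsometry.isStarProjection.mem_range_iff.1 h2
    have h4 : ContinuousLinearMap.adjoint X (X x) = 0 := h1
    rw [← h3, ← initial_initial_eq hU hX h, h3, h4]
  rw [pairIndex, h0, finrank_bot, ← range_domRestrict_inf_eq hU hX h,
    LinearMap.finrank_range_of_inj (injective_domRestrict_range_initial hX inf_le_left)]
  simp

theorem finiteDimensional_of_injective_of_range_le {V W : Type*} [AddCommGroup V] [Module ℂ V]
    [AddCommGroup W] [Module ℂ W] {T : V →ₗ[ℂ] W} (hT : Function.Injective T) {N : Submodule ℂ W}
    [FiniteDimensional ℂ N] (h : LinearMap.range T ≤ N) : FiniteDimensional ℂ V :=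
  FiniteDimensional.of_injective (T.codRestrict N fun x => h ⟨x, rfl⟩)
    ((LinearMap.injective_codRestrict_iff _).2 hT)

theorem isFredholmPair_of_finiteDimensional (hU : IsPolarIsometry F U) (hX : IsPartialIsometry X)
    (h : ∀ x, X (ContinuousLinearMap.adjoint U (U x)) = U x)
    [FiniteDimensional ℂ ((LinearMap.ker F.toLinearMap).map X.toLinearMap)] :
    IsFredholmPair (ContinuousLinearMap.adjoint U ∘L U) (ContinuousLinearMap.adjoint X ∘L X) := by
  have h1 := injective_domRestrict_range_initial hX (N :=
    LinearMap.range (ContinuousLinearMap.adjoint X ∘L X).toLinearMap ⊓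
        LinearMap.ker (ContinuousLinearMap.adjoint U ∘L U).toLinearMap) inf_le_left
  have h2 := (range_domRestrict_inf_eq hU hX h).le
  have := finiteDimensional_of_injective_of_range_le h1 h2
  have h3 := hU.isPartialIsometry.isStarProjection
  have h4 := hX.isStarProjection
  have h5 := initial_initial_eq hU hX h
  have h6 := initial_initial_eq' hU hX h
  refine isFredholmPair_of_comp_eq h3 h4 ?_ ?_
  · exact h5
  · exact h6

theorem IsPolarIsometry.inner_apply_eq_zero (hU : IsPolarIsometry F U) (x : E) {y : G}
    (hy : y ∈ (LinearMap.range F.toLinearMap)ᗮ) : inner ℂ (U x) y = 0 := by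
  have h1 : ContinuousLinearMap.adjoint F y = 0 := by
    rw [ContinuousLinearMap.orthogonal_range] at hy
    exact hy
  have h2 : modulus F (ContinuousLinearMap.adjoint U y) = ContinuousLinearMap.adjoint F y := by
    have := congrArg ContinuousLinearMap.adjoint hU.eq_comp
    rw [ContinuousLinearMap.adjoint_comp, modulus_isSelfAdjoint] at this
    exact (congrArg (fun T : G →L[ℂ] E => T y) this).symm
  rw [h1, ← norm_eq_zero, norm_modulus_apply, norm_eq_zero, ← hU.apply_eq_zero_iff] at h2
  have h3 : ContinuousLinearMap.adjoint U y = 0 := by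
    rw [← adjoint_comp_adjoint_of_comp_adjoint_comp hU.isPartialIsometry.comp_adjoint_comp, h2,
      map_zero]
  rw [← ContinuousLinearMap.adjoint_inner_right, h3, inner_zero_right]

/-- The values of `U` and `S` are orthogonal, so norms add by Pythagoras; if `x ⊥ ker X`, then its
component in `ker F` is orthogonal to `ker S`. -/
theorem isPartialIsometry_of_extends (hU : IsPolarIsometry F U)
    {S : LinearMap.ker F.toLinearMap →L[ℂ] (LinearMap.range F.toLinearMap)ᗮ}
    (hS : IsPartialIsometry S) (h : ∀ x, X (ContinuousLinearMap.adjoint U (U x)) = U x)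
    (hXS : ∀ m : LinearMap.ker F.toLinearMap, X m = S m) : IsPartialIsometry X := by
  intro x hx
  set p := ContinuousLinearMap.adjoint U (U x) with hp
  have hP := hU.isPartialIsometry.isStarProjection
  have hn : x - p ∈ LinearMap.ker F.toLinearMap := by
    change F (x - p) = 0
    rw [map_sub, hp, hU.apply_initial, sub_self]
  have hSn : ‖S ⟨x - p, hn⟩‖ = ‖x - p‖ := by
    refine hS _ ((Submodule.mem_orthogonal _ _).2 fun m hm => ?_)
    have h1 : inner ℂ (m : E) x = 0 := by
      refine (Submodule.mem_orthogonal _ _).1 hx _ ?_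
      change X m = 0
      have : S m = 0 := hm
      rw [hXS, this, Submodule.coe_zero]
    have h2 : inner ℂ (m : E) p = 0 := by
      have h3 : ContinuousLinearMap.adjoint U (U m) = 0 := (initial_eq_zero_iff hU m).2 m.2
      have h4 := hP.inner_left (m : E) x
      simp only [ContinuousLinearMap.comp_apply, h3, inner_zero_left] at h4
      exact h4.symm
    change inner ℂ (m : E) (x - p) = 0
    rw [inner_sub_right, h1, h2, sub_zero]
  have hx' : X x = U x + S ⟨x - p, hn⟩ := by
    rw [← hXS, ← h x, ← map_add, add_sub_cancel]
  have h1 := norm_add_sq_eq_norm_sq_add_norm_sq_of_inner_eq_zero (U x) (S ⟨x - p, hn⟩ : G)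
    (hU.inner_apply_eq_zero x (S ⟨x - p, hn⟩).2)
  rw [← hx'] at h1
  have h2 := hU.isPartialIsometry.norm_sq_eq x
  rw [Submodule.norm_coe, hSn] at h1
  refine (sq_eq_sq₀ (norm_nonneg _) (norm_nonneg _)).1 ?_
  rw [h2, sq, h1, sq, sq]

/-- `S` is the restriction of `X` to `ker F`. Its values are orthogonal to `ran F` because `F z = X
|F| z` with `|F| z` in the initial space of `X`, so that `⟨F z, X m⟩ = ⟨|F| z, m⟩ = 0`. -/
theorem exists_isPartialIsometry_of_agree (hU : IsPolarIsometry F U) (hX : IsPartialIsometry X)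
    (h : ∀ x, X (ContinuousLinearMap.adjoint U (U x)) = U x) :
    ∃ S : LinearMap.ker F.toLinearMap →L[ℂ] (LinearMap.range F.toLinearMap)ᗮ,
      IsPartialIsometry S ∧ ∀ m : LinearMap.ker F.toLinearMap, X m = S m := by
  have hmem : ∀ m : LinearMap.ker F.toLinearMap, X m ∈ (LinearMap.range F.toLinearMap)ᗮ := by
    intro m
    rw [Submodule.mem_orthogonal]
    rintro _ ⟨z, rfl⟩
    have h1 : F z = X (modulus F z) := by
      rw [← hU.apply_modulus, ← h, hU.initial_modulus]
    have h2 : ContinuousLinearMap.adjoint X (X (modulus F z)) = modulus F z := by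
      rw [← hU.initial_modulus, initial_initial_eq hU hX h]
    have h3 : modulus F m = 0 := by
      have : F m = 0 := m.2
      rw [← norm_eq_zero, norm_modulus_apply, this, norm_zero]
    change inner ℂ (F z) (X m) = 0
    rw [h1, ← ContinuousLinearMap.adjoint_inner_left, h2, modulus_inner_left, h3,
      inner_zero_right]
  refine ⟨(X ∘L (LinearMap.ker F.toLinearMap).subtypeL).codRestrict _ hmem, ?_, fun m => rfl⟩
  intro m hm
  -- `m - X*X m` stays in `ker F` and is killed by `X`, so it lies in `ker S` and can be tested
  -- against `m ∈ (ker S)ᗮ`.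
  have hq : F (m - ContinuousLinearMap.adjoint X (X m)) = 0 := by
    rw [← initial_eq_zero_iff hU, map_sub, map_sub, initial_initial_eq' hU hX h, sub_self]
  have h1 : inner ℂ ((m : E) - ContinuousLinearMap.adjoint X (X m)) (m : E) = 0 := by
    refine (Submodule.mem_orthogonal _ _).1 hm ⟨_, hq⟩ ?_
    rw [LinearMap.mem_ker]
    refine Subtype.ext ?_
    change X (m - ContinuousLinearMap.adjoint X (X m)) = 0
    rw [map_sub, hX.comp_adjoint_comp, sub_self]
  change ‖X m‖ = ‖(m : E)‖
  have h2 : inner ℂ (m : E) (m : E) = inner ℂ (X m) (X m) := by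
    rw [inner_sub_left, sub_eq_zero, ContinuousLinearMap.adjoint_inner_left] at h1
    exact h1
  refine (sq_eq_sq₀ (norm_nonneg _) (norm_nonneg _)).1 ?_
  rw [← inner_self_eq_norm_sq (𝕜 := ℂ), ← inner_self_eq_norm_sq (𝕜 := ℂ), h2]

theorem map_ker_eq_map_range
    {S : LinearMap.ker F.toLinearMap →L[ℂ] (LinearMap.range F.toLinearMap)ᗮ}
    (hXS : ∀ m : LinearMap.ker F.toLinearMap, X m = S m) :
    (LinearMap.ker F.toLinearMap).map X.toLinearMap
      = (LinearMap.range S.toLinearMap).map (LinearMap.range F.toLinearMap)ᗮ.subtype := by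
  ext y
  constructor
  · rintro ⟨m, hm, rfl⟩
    exact ⟨S ⟨m, hm⟩, ⟨_, rfl⟩, (hXS ⟨m, hm⟩).symm⟩
  · rintro ⟨_, ⟨m, rfl⟩, rfl⟩
    exact ⟨m, m.2, hXS m⟩

theorem hsSq_ne_top_of_finiteDimensional_range (T : E →L[ℂ] G) {N : Submodule ℂ G}
    [FiniteDimensional ℂ N] (hT : ∀ x, T x ∈ N) : hsSq T ≠ ∞ := by
  have h1 : N.starProjection ∘L T = T := by
    ext x
    exact Submodule.starProjection_eq_self_iff.2 (hT x)
  rw [← h1]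
  refine hsSq_comp_right_ne_top _ ?_
  rw [hsSq_starProjection, hsSq_subtypeL]
  exact ENNReal.natCast_ne_top _

end Extensions

/-! ### Dimensions in `ℕ∞` and partial isometries of prescribed rank. -/

section Dimension

theorem dim_eq_natCast_iff {V : Type*} [AddCommGroup V] [Module ℂ V] {n : ℕ} :
    dim V = n ↔ FiniteDimensional ℂ V ∧ Module.finrank ℂ V = n := by
  rw [dim, Cardinal.toENat_eq_natCast]
  constructor
  · intro h
    refine ⟨?_, Module.finrank_eq_of_rank_eq h⟩
    rw [FiniteDimensional, ← Module.rank_lt_aleph0_iff, h]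
    exact Cardinal.natCast_lt_aleph0
  · rintro ⟨h, rfl⟩
    exact (Module.finrank_eq_rank ℂ V).symm

theorem exists_submodule_finrank_eq {V : Type*} [AddCommGroup V] [Module ℂ V] {n : ℕ}
    (h : (n : ℕ∞) ≤ dim V) :
    ∃ W : Submodule ℂ V, FiniteDimensional ℂ W ∧ Module.finrank ℂ W = n := by
  rw [dim, Cardinal.natCast_le_toENat, Module.le_rank_iff] at h
  obtain ⟨v, hv⟩ := h
  exact ⟨Submodule.span ℂ (Set.range v), FiniteDimensional.span_of_finite ℂ (Set.finite_range v),
    by simpa using finrank_span_eq_card hv⟩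

/-- Partial isometries of every admissible finite rank exist. -/
theorem exists_isPartialIsometry_dim_range_eq {V W : Type*} [NormedAddCommGroup V]
    [InnerProductSpace ℂ V] [NormedAddCommGroup W] [InnerProductSpace ℂ W] {n : ℕ}
    (hV : (n : ℕ∞) ≤ dim V) (hW : (n : ℕ∞) ≤ dim W) :
    ∃ S : V →L[ℂ] W, IsPartialIsometry S ∧ dim (LinearMap.range S.toLinearMap) = n := by
  obtain ⟨A, hA, hAn⟩ := exists_submodule_finrank_eq hV
  obtain ⟨B, hB, hBn⟩ := exists_submodule_finrank_eq hW
  let J : A ≃ₗᵢ[ℂ] B := (stdOrthonormalBasis ℂ A).equiv (stdOrthonormalBasis ℂ B)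
    (finCongr (hAn.trans hBn.symm))
  let S : V →L[ℂ] W := B.subtypeL ∘L J.toContinuousLinearEquiv.toContinuousLinearMap
    ∘L A.orthogonalProjectionOnto
  have hS : ∀ x, S x = J (A.orthogonalProjectionOnto x) := fun x => rfl
  refine ⟨S, fun x hx => ?_, ?_⟩
  · have hxA : x ∈ A := by
      rw [← Submodule.orthogonal_orthogonal A]
      refine Submodule.orthogonal_le ?_ hx
      intro y hy
      rw [LinearMap.mem_ker, ContinuousLinearMap.coe_coe, hS,
        Submodule.orthogonalProjectionOnto_eq_zero_iff.2 hy, map_zero, Submodule.coe_zero]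
    have h1 := Submodule.orthogonalProjectionOnto_mem_subspace_eq_self (K := A) ⟨x, hxA⟩
    simp only at h1
    rw [hS, h1, Submodule.norm_coe, J.norm_map, Submodule.coe_norm]
  · have : LinearMap.range S.toLinearMap = B := by
      ext y
      constructor
      · rintro ⟨x, rfl⟩
        exact (J _).2
      · intro hy
        refine ⟨J.symm ⟨y, hy⟩, ?_⟩
        rw [ContinuousLinearMap.coe_coe, hS,
          Submodule.orthogonalProjectionOnto_mem_subspace_eq_self, J.apply_symm_apply]
    rw [this, dim_eq_natCast_iff]
    exact ⟨hB, hBn⟩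

end Dimension

/-! ### Symmetric approximations: membership, minimality, uniqueness of form, infinitude. -/

section SymmetricApproximation

variable {H : Type*} [NormedAddCommGroup H] [InnerProductSpace ℂ H] [CompleteSpace H]

/-- The operator with `e i ↦ perturbedCanonical f S i`. -/
noncomputable def perturbedOperator (f : ℕ → H)
    (S : LinearMap.ker (synthesis f).toLinearMap →L[ℂ]
      (LinearMap.range (synthesis f).toLinearMap)ᗮ) : Seq2 →L[ℂ] H :=
  polarIsometry (synthesis f) + (LinearMap.range (synthesis f).toLinearMap)ᗮ.subtypeL ∘L S ∘L
    (ContinuousLinearMap.id ℂ Seq2 - ContinuousLinearMap.adjoint (polarIsometry (synthesis f))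
      ∘L polarIsometry (synthesis f)).codRestrict _ (sub_adjoint_comp_mem_ker (synthesis f))

variable {f : ℕ → H} {S : LinearMap.ker (synthesis f).toLinearMap →L[ℂ]
      (LinearMap.range (synthesis f).toLinearMap)ᗮ}

theorem perturbedCanonical_eq :
    perturbedCanonical f S = fun i => perturbedOperator f S (e i) := rfl

theorem perturbedOperator_apply (x : Seq2) :
    perturbedOperator f S x = polarIsometry (synthesis f) x
      + S ⟨_, sub_adjoint_comp_mem_ker (synthesis f) x⟩ := rfl

theorem perturbedOperator_initial (x : Seq2) :
    perturbedOperator f S (ContinuousLinearMap.adjoint (polarIsometry (synthesis f))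
      (polarIsometry (synthesis f) x)) = polarIsometry (synthesis f) x := by
  have h := (polarIsometry_spec (synthesis f)).isPartialIsometry.comp_adjoint_comp
  rw [perturbedOperator_apply, h]
  have : (⟨_, sub_adjoint_comp_mem_ker (synthesis f)
      (ContinuousLinearMap.adjoint (polarIsometry (synthesis f))
      (polarIsometry (synthesis f) x))⟩ : LinearMap.ker (synthesis f).toLinearMap) = 0 := by
    refine Subtype.ext ?_
    simp [h]
  rw [this, map_zero, Submodule.coe_zero, add_zero]

theorem perturbedOperator_ker (m : LinearMap.ker (synthesis f).toLinearMap) :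
    perturbedOperator f S m = S m := by
  have h : polarIsometry (synthesis f) m = 0 :=
    ((polarIsometry_spec (synthesis f)).apply_eq_zero_iff m).2 m.2
  rw [perturbedOperator_apply, h, zero_add]
  congr 2
  refine Subtype.ext ?_
  simp [h]

theorem perturbedCanonical_injective : Function.Injective (perturbedCanonical f) := by
  intro S T h
  rw [perturbedCanonical_eq, perturbedCanonical_eq] at h
  have h1 : perturbedOperator f S = perturbedOperator f T := ext_e fun i => congrFun h i
  ext m
  rw [← perturbedOperator_ker, h1, perturbedOperator_ker]

theorem sqDist_comm (x y : ℕ → H) : sqDist x y = sqDist y x := by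
  simp only [sqDist, ← ofReal_norm, norm_sub_rev]

variable {K : Submodule ℂ H} {n : ℕ}

theorem IsFrameIn.sqDist_eq_hsSq (hf : IsFrameIn K f) (T : Seq2 →L[ℂ] H) :
    sqDist f (fun i => T (e i)) = hsSq (synthesis f - T) := by
  rw [← FrameApprox.sqDist_eq_hsSq]
  simp only [hf.synthesis_apply]

theorem exists_partialIsometry_of_mem_closeParseval (hf : IsFrameIn K f) {x : ℕ → H}
    (hx : x ∈ closeParseval f) : ∃ X : Seq2 →L[ℂ] H, x = (fun i => X (e i)) ∧ synthesis x = X ∧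
      IsPartialIsometry X ∧ sqDist f x = hsSq (synthesis f - X) ∧ hsSq (synthesis f - X) ≠ ∞ := by
  obtain ⟨⟨L, hL⟩, hd⟩ := hx
  have h1 : x = fun i => synthesis x (e i) := funext fun i => (hL.isFrameIn.synthesis_apply i).symm
  have h2 : sqDist f x = hsSq (synthesis f - synthesis x) := by
    conv_lhs => rw [h1]
    exact hf.sqDist_eq_hsSq _
  refine ⟨synthesis x, h1, rfl, hL.isPartialIsometry, h2, ?_⟩
  rw [← h2, sqDist_comm]
  exact hd.ne

theorem hsSq_sub_polarIsometry_ne_top (hf : IsFrameIn K f) (hQ : (closeParseval f).Nonempty) :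
    hsSq (synthesis f - polarIsometry (synthesis f)) ≠ ∞ := by
  obtain ⟨x, hx⟩ := hQ
  obtain ⟨X, -, -, hX, -, hd⟩ := exists_partialIsometry_of_mem_closeParseval hf hx
  obtain ⟨c, hc, hlow⟩ := hf.exists_lower_bound
  refine hsSq_sub_initial_ne_top (polarIsometry_spec _) hc hlow hX ?_
  rwa [← hsSq_neg, neg_sub]

/-- The distance from `f` to a member of `𝒬_ℱ^{-n}`. -/
theorem exists_sqDist_eq (hf : IsFrameIn K f) {x : ℕ → H}
    (hx : x ∈ closeParsevalIndex f (-n)) :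
    ∃ R : ℝ≥0∞, (R = 0 ↔ ∀ y, synthesis x
        (ContinuousLinearMap.adjoint (polarIsometry (synthesis f))
          (polarIsometry (synthesis f) y)) = polarIsometry (synthesis f) y) ∧
      sqDist f x = hsSq (synthesis f - polarIsometry (synthesis f)) + n + R := by
  obtain ⟨hxQ, -, hi⟩ := hx
  have hFU := hsSq_sub_polarIsometry_ne_top hf ⟨x, hxQ⟩
  obtain ⟨X, -, rfl, hX, hd, hfin⟩ := exists_partialIsometry_of_mem_closeParseval hf hxQ
  rw [hd]
  exact exists_hsSq_sub_eq (polarIsometry_spec _) hFU hX hfin hi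

theorem perturbedCanonical_mem (hf : IsFrameIn K f) (hQ : (closeParseval f).Nonempty)
    (hS : IsPartialIsometry S) (hn : dim (LinearMap.range S.toLinearMap) = n) :
    perturbedCanonical f S ∈ closeParsevalIndex f (-n) := by
  obtain ⟨hfin, hn⟩ := dim_eq_natCast_iff.1 hn
  have hU := polarIsometry_spec (synthesis f)
  have hY : IsPartialIsometry (perturbedOperator f S) :=
    isPartialIsometry_of_extends hU hS perturbedOperator_initial perturbedOperator_ker
  have hmap : (LinearMap.ker (synthesis f).toLinearMap).map (perturbedOperator f S).toLinearMap
      = _ := map_ker_eq_map_range perturbedOperator_ker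
  have hfd : FiniteDimensional ℂ ((LinearMap.ker (synthesis f).toLinearMap).map
      (perturbedOperator f S).toLinearMap) := by
    rw [hmap]
    infer_instance
  rw [perturbedCanonical_eq]
  refine ⟨⟨hY.exists_isParsevalFrameIn, ?_⟩, ?_, ?_⟩
  · rw [sqDist_comm, hf.sqDist_eq_hsSq, lt_top_iff_ne_top]
    have : synthesis f - perturbedOperator f S = (synthesis f - polarIsometry (synthesis f))
        - (perturbedOperator f S - polarIsometry (synthesis f)) := by abel
    rw [this]
    -- The perturbed operator differs from `U` by an operator with values in the finite-dimensional
    -- image of `ker F`.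
    refine hsSq_sub_ne_top (hsSq_sub_polarIsometry_ne_top hf hQ)
      (hsSq_ne_top_of_finiteDimensional_range _ (N :=
        (LinearMap.ker (synthesis f).toLinearMap).map (perturbedOperator f S).toLinearMap)
        fun x => ?_)
    refine ⟨_, sub_adjoint_comp_mem_ker (synthesis f) x, ?_⟩
    rw [ContinuousLinearMap.coe_coe, sub_apply, sub_apply, map_sub]
    congr 1
    exact perturbedOperator_initial x
  · rw [synthesis_apply_e]
    exact isFredholmPair_of_finiteDimensional hU hY perturbedOperator_initial
  · rw [synthesis_apply_e, pairIndex_eq_neg_finrank hU hY perturbedOperator_initial, hmap,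
      Submodule.finrank_map_subtype_eq, hn]

theorem sqDist_perturbedCanonical (hf : IsFrameIn K f) (hQ : (closeParseval f).Nonempty)
    (hS : IsPartialIsometry S) (hn : dim (LinearMap.range S.toLinearMap) = n) :
    sqDist f (perturbedCanonical f S)
      = hsSq (synthesis f - polarIsometry (synthesis f)) + n := by
  obtain ⟨R, hR, h⟩ := exists_sqDist_eq hf (perturbedCanonical_mem hf hQ hS hn)
  rw [perturbedCanonical_eq, synthesis_apply_e] at hR
  rw [h, hR.2 perturbedOperator_initial, add_zero]

theorem sqDist_perturbedCanonical_le (hf : IsFrameIn K f)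
    (hS : IsPartialIsometry S) (hn : dim (LinearMap.range S.toLinearMap) = n) {x : ℕ → H}
    (hx : x ∈ closeParsevalIndex f (-n)) :
    sqDist f (perturbedCanonical f S) ≤ sqDist f x := by
  obtain ⟨R, -, h⟩ := exists_sqDist_eq hf hx
  rw [sqDist_perturbedCanonical hf ⟨x, hx.1⟩ hS hn, h]
  exact le_self_add

theorem isSymmetricApproximation_perturbedCanonical (hf : IsFrameIn K f)
    (hQ : (closeParseval f).Nonempty) (hS : IsPartialIsometry S)
    (hn : dim (LinearMap.range S.toLinearMap) = n) :
    IsSymmetricApproximation f (closeParsevalIndex f (-n)) (perturbedCanonical f S) := by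
  have h := perturbedCanonical_mem hf hQ hS hn
  refine ⟨h, ?_, fun x hx => sqDist_perturbedCanonical_le hf hS hn hx⟩
  rw [sqDist_comm]
  exact h.1.2

theorem exists_eq_perturbedCanonical (hf : IsFrameIn K f) (hn0 : 0 < n) {y : ℕ → H}
    (hy : y ∈ closeParsevalIndex f (-n))
    (hd : sqDist f y ≤ hsSq (synthesis f - polarIsometry (synthesis f)) + n) :
    ∃ T : LinearMap.ker (synthesis f).toLinearMap →L[ℂ]
        (LinearMap.range (synthesis f).toLinearMap)ᗮ,
      IsPartialIsometry T ∧ dim (LinearMap.range T.toLinearMap) = n ∧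
        y = perturbedCanonical f T := by
  have hU := polarIsometry_spec (synthesis f)
  have hFU := hsSq_sub_polarIsometry_ne_top hf ⟨y, hy.1⟩
  obtain ⟨R, hR, h⟩ := exists_sqDist_eq hf hy
  have hR0 : R = 0 := by
    rw [h] at hd
    refine nonpos_iff_eq_zero.1 ((ENNReal.add_le_add_iff_left
      (ENNReal.add_ne_top.2 ⟨hFU, ENNReal.natCast_ne_top n⟩)).1 ?_)
    rwa [add_zero]
  have hXU := hR.1 hR0
  obtain ⟨X, hyX, hX', hX, -, -⟩ := exists_partialIsometry_of_mem_closeParseval hf hy.1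
  rw [hX'] at hXU
  obtain ⟨T, hT, hXT⟩ := exists_isPartialIsometry_of_agree hU hX hXU
  refine ⟨T, hT, ?_, ?_⟩
  · have hi := hy.2.2
    rw [hX', pairIndex_eq_neg_finrank hU hX hXU, map_ker_eq_map_range hXT,
      Submodule.finrank_map_subtype_eq, neg_inj, Nat.cast_inj] at hi
    -- `finrank` is also `0` for infinite-dimensional spaces; `n > 0` excludes that here.
    exact dim_eq_natCast_iff.2 ⟨Module.finite_of_finrank_pos (by omega), hi⟩
  · rw [hyX, perturbedCanonical_eq]
    funext i
    rw [perturbedOperator_apply, ← hXT, ← hXU, ← map_add]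
    congr 1
    simp

theorem infinite_symmetricApproximations (hf : IsFrameIn K f)
    (hQ : (closeParseval f).Nonempty) (hS : IsPartialIsometry S)
    (hn : dim (LinearMap.range S.toLinearMap) = n) (hn0 : 0 < n) :
    {y | IsSymmetricApproximation f (closeParsevalIndex f (-n)) y}.Infinite := by
  have hS0 : S ≠ 0 := by
    rintro rfl
    have h := (dim_eq_natCast_iff.1 hn).2
    have h0 : LinearMap.range (0 : LinearMap.ker (synthesis f).toLinearMap →L[ℂ]
        (LinearMap.range (synthesis f).toLinearMap)ᗮ).toLinearMap = ⊥ := LinearMap.range_zero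
    rw [h0, finrank_bot] at h
    omega
  -- Unimodular scalars with distinct angles in `(0, 1]`, inside the principal range of `arg`;
  -- scaling `S` by them changes neither its kernel, its range nor its norms.
  let c : ℕ → ℂ := fun j => Circle.exp (1 / ((j : ℝ) + 1))
  have hcn : ∀ j, ‖c j‖ = 1 := fun j => Circle.norm_coe _
  have hc : Function.Injective c := by
    intro i j hij
    have hm : ∀ j : ℕ, -Real.pi < 1 / ((j : ℝ) + 1) ∧ 1 / ((j : ℝ) + 1) ≤ Real.pi := fun j => by
      have h1 : (0 : ℝ) < 1 / ((j : ℝ) + 1) := by positivity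
      have h2 : 1 / ((j : ℝ) + 1) ≤ 1 := by
        rw [div_le_one (by positivity)]
        linarith [(Nat.cast_nonneg j : (0 : ℝ) ≤ j)]
      have := Real.pi_gt_three
      constructor <;> linarith
    have h1 := congrArg Complex.arg hij
    simp only [c] at h1
    rw [Circle.arg_exp (hm i).1 (hm i).2, Circle.arg_exp (hm j).1 (hm j).2] at h1
    have h2 : (i : ℝ) + 1 = (j : ℝ) + 1 := by
      simpa using h1
    exact_mod_cast add_right_cancel h2
  have hc0 : ∀ j, c j ≠ 0 := fun j h => by
    have := hcn j
    rw [h, norm_zero] at this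
    exact zero_ne_one this
  refine Set.infinite_of_injective_forall_mem (f := fun j => perturbedCanonical f (c j • S))
    (fun i j hij => hc (smul_left_injective ℂ hS0 (perturbedCanonical_injective hij)))
    fun j => isSymmetricApproximation_perturbedCanonical hf hQ ?_ ?_
  · intro x hx
    rw [smul_apply, norm_smul, hcn, one_mul]
    refine hS x ?_
    rw [ContinuousLinearMap.toLinearMap_smul, LinearMap.ker_smul _ _ (hc0 j)] at hx
    exact hx
  · rw [ContinuousLinearMap.toLinearMap_smul, LinearMap.range_smul _ _ (hc0 j), hn]

end SymmetricApproximation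

end FrameApprox

theorem theorem4p7 {H : Type*} [NormedAddCommGroup H] [InnerProductSpace ℂ H] [CompleteSpace H]
    (K : Submodule ℂ H) (f : ℕ → H) (hf : FrameApprox.IsFrameIn K f)
    (hQ : (FrameApprox.closeParseval f).Nonempty)
    (h1 : 0 < FrameApprox.dim (LinearMap.ker (FrameApprox.synthesis f).toLinearMap))
    (h3 : 0 < FrameApprox.dim Kᗮ)
    (k : ℤ) (hk : k ≤ -1)
    (hk' : ((-k).toNat : ℕ∞) ≤
      min (FrameApprox.dim (LinearMap.ker (FrameApprox.synthesis f).toLinearMap))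
        (FrameApprox.dim (LinearMap.range (FrameApprox.synthesis f).toLinearMap)ᗮ)) :
    (∀ S : LinearMap.ker (FrameApprox.synthesis f).toLinearMap →L[ℂ]
        (LinearMap.range (FrameApprox.synthesis f).toLinearMap)ᗮ,
      FrameApprox.IsPartialIsometry S →
      FrameApprox.dim (LinearMap.range S.toLinearMap) = ((-k).toNat : ℕ∞) →
      ∀ x ∈ FrameApprox.closeParsevalIndex f k,
        FrameApprox.sqDist f (FrameApprox.perturbedCanonical f S) ≤ FrameApprox.sqDist f x) ∧
    {y | FrameApprox.IsSymmetricApproximation f (FrameApprox.closeParsevalIndex f k) y}.Infinite ∧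
    (∀ y : ℕ → H,
      FrameApprox.IsSymmetricApproximation f (FrameApprox.closeParsevalIndex f k) y ↔
      ∃ S : LinearMap.ker (FrameApprox.synthesis f).toLinearMap →L[ℂ]
          (LinearMap.range (FrameApprox.synthesis f).toLinearMap)ᗮ,
        FrameApprox.IsPartialIsometry S ∧
        FrameApprox.dim (LinearMap.range S.toLinearMap) = ((-k).toNat : ℕ∞) ∧
        y = FrameApprox.perturbedCanonical f S) := by

  obtain ⟨n, rfl⟩ : ∃ n : ℕ, k = -n := ⟨(-k).toNat, by omega⟩
  have hn0 : 0 < n := by omega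
  rw [neg_neg, Int.toNat_natCast] at *
  -- One `S₀` of rank `n` shows that the value `‖F - U‖² + n` is attained, so every minimiser has
  -- zero remainder.
  obtain ⟨S₀, hS₀, hd₀⟩ := FrameApprox.exists_isPartialIsometry_dim_range_eq
    (hk'.trans (min_le_left _ _)) (hk'.trans (min_le_right _ _))
  refine ⟨fun S hS hd x hx => FrameApprox.sqDist_perturbedCanonical_le hf hS hd hx,
    FrameApprox.infinite_symmetricApproximations hf hQ hS₀ hd₀ hn0, fun y => ⟨fun hy => ?_, ?_⟩⟩
  · refine FrameApprox.exists_eq_perturbedCanonical hf hn0 hy.1 ?_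
    rw [← FrameApprox.sqDist_perturbedCanonical hf hQ hS₀ hd₀]
    exact hy.2.2 _ (FrameApprox.perturbedCanonical_mem hf hQ hS₀ hd₀)
  · rintro ⟨S, hS, hd, rfl⟩
    exact FrameApprox.isSymmetricApproximation_perturbedCanonical hf hQ hS hd
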